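/- **Setting.** Let $E$ be a finite-dimensional $\mathbb{Q}$-vector space with a positive definite symmetric bilinear form $(\;,\;)$, put $\alpha^\vee=\frac{2}{(\alpha,\alpha)}\alpha$ for $0\ne\alpha\in E$, and let $\Phi\subseteq E$ be an irreducible reduced crystallographic root system spanning $E$, with simple roots $\{\alpha_i\mid i\in I\}$, simple reflections $s_i(v)=v-(v,\alpha_i^\vee)\alpha_i$, and Weyl group $W$. Let $\Lambda$ be the weight lattice, i.e. the $\mathbb{Z}$-span of the basis of $E$ dual to $\{\alpha_i^\vee\mid i\in I\}$. A minuscule weight is a nonzero $\lambda\in\Lambda$ with $(\lambda,\alpha_i^\vee)\ge 0$ for all $i\in I$ and $(\lambda,\alpha^\vee)\in\{0,\pm1\}$ for all $\alpha\in\Phi$. Let $\Psi\subseteq\Lambda$ be a non-empty union of $W$-orbits of minuscule weights, and let $M$ be a $\mathbb{C}$-vector space with basis $\{z_\mu\mid\mu\in\Psi\}$. For $i\in I$ define linear maps $e_i,f_i\colon M\to M$ by $$e_i(z_\mu)=\begin{cases}z_{\mu+\alpha_i}&\text{if }(\mu,\alpha_i^\vee)=-1,\\0&\text{otherwise,}\end{cases}\qquad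 f_i(z_\mu)=\begin{cases}z_{\mu-\alpha_i}&\text{if }(\mu,\alpha_i^\vee)=1,\\0&\text{otherwise,}\end{cases}$$ and put $n_i=(\mathrm{id}_M+e_i)(\mathrm{id}_M-f_i)(\mathrm{id}_M+e_i)\in\mathrm{GL}(M)$. For each $\alpha\in\Phi$ choose $k\ge0$ and $i,i_1,\dots,i_k\in I$ with $\alpha=s_{i_1}\cdots s_{i_k}(\alpha_i)$, and set $$\mathbf{e}_\alpha:=n_{i_1}\cdots n_{i_k}\,e_i\,n_{i_k}^{-1}\cdots n_{i_1}^{-1}.$$ **Proposition 2.5.** Let the elements $\mathbf{e}_\alpha$ be obtained from any such choice, and let $\alpha,\beta\in\Phi$ with $\beta\neq\pm\alpha$. (a) If $\alpha+\beta\notin\Phi$, then $[\mathbf{e}_\alpha,\mathbf{e}_\beta]=0$ and $\mathbf{e}_\beta\mathbf{e}_\alpha\mathbf{e}_\beta=0$. (b) If $\alpha+\beta\in\Phi$, then $[\mathbf{e}_\alpha,\mathbf{e}_\beta]=c\,\mathbf{e}_{\alpha+\beta}$ for some $c\in\{\pm1,\pm2\}$, where $c=\pm2$ if and only if $\alpha-\beta\in\Phi$.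 (c) If $\alpha+\beta\in\Phi$ and $2\alpha+\beta\notin\Phi$, then $xy=0$ for all $x,y\in\{\mathbf{e}_\alpha,\;[\mathbf{e}_\alpha,\mathbf{e}_\beta],\;\mathbf{e}_\beta\mathbf{e}_\alpha\mathbf{e}_\beta\}$. Furthermore, $\mathbf{e}_\beta\mathbf{e}_\alpha\mathbf{e}_\beta=c'\,\mathbf{e}_{\alpha+2\beta}$ for some sign $c'=\pm1$ if $\alpha+2\beta\in\Phi$, and $\mathbf{e}_\beta\mathbf{e}_\alpha\mathbf{e}_\beta=0$ if $\alpha+2\beta\notin\Phi$. -/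

import Mathlib

noncomputable section

namespace MinusculeModel

open Module

variable {ι E N : Type*} [AddCommGroup E] [Module ℚ E] [AddCommGroup N] [Module ℚ N]

/-! In what follows `P` is a root system over `ℚ` in `E`; the number `(v, α^∨)`, for `v` in `E` and
`α = P.root i`, is `P.coroot' i v`. A set of simple roots is a base `b` of `P`. -/

/-- The set `Φ` of roots, as a subset of `E`. -/
def roots (P : RootPairing ι ℚ E N) : Set E := Set.range P.root

open Classical in
/-- The fundamental weights: the basis of `E` dual to the simple coroots. -/
def fundamentalWeights {P : RootPairing ι ℚ E N} (b : P.Base) : Set E :=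
  {ϖ | ∃ i ∈ b.support, ∀ j ∈ b.support, P.coroot' j ϖ = if j = i then 1 else 0}

/-- The weight lattice `Λ`. -/
def weightLattice {P : RootPairing ι ℚ E N} (b : P.Base) : Submodule ℤ E :=
  Submodule.span ℤ (fundamentalWeights b)

/-- A minuscule weight: a nonzero dominant weight `v` with `(v, α^∨) ∈ {0, 1, -1}` for all roots
`α`. -/
structure IsMinuscule {P : RootPairing ι ℚ E N} (b : P.Base) (v : E) : Prop where
  mem_weightLattice : v ∈ weightLattice b
  ne_zero : v ≠ 0
  dominant : ∀ i ∈ b.support, 0 ≤ P.coroot' i v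
  pairing_mem : ∀ k : ι, P.coroot' k v ∈ ({0, 1, -1} : Set ℚ)

/-- `Ψ` is a non-empty union of Weyl group orbits of minuscule weights. -/
def IsUnionOfMinusculeOrbits {P : RootPairing ι ℚ E N} (b : P.Base) (Ψ : Set E) : Prop :=
  Ψ.Nonempty ∧
    ∃ S : Set E, (∀ v ∈ S, IsMinuscule b v) ∧ Ψ = ⋃ v ∈ S, MulAction.orbit P.weylGroup v

theorem IsUnionOfMinusculeOrbits.reflection_mem {P : RootPairing ι ℚ E N} {b : P.Base} {Ψ : Set E}
    (hΨ : IsUnionOfMinusculeOrbits b Ψ) {μ : E} (hμ : μ ∈ Ψ) (i : ι) : P.reflection i μ ∈ Ψ := by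
  obtain ⟨-, S, -, rfl⟩ := hΨ
  simp only [Set.mem_iUnion] at hμ ⊢
  obtain ⟨v, hv, hμ⟩ := hμ
  refine ⟨v, hv, ?_⟩
  have h := (MulAction.mem_orbit_of_mem_orbit (RootPairing.weylGroup.ofIdx P i) hμ)
  simpa using h

/-- If `(μ, α_i^∨) = -1`, then `μ + α_i` is again in `Ψ`. -/
theorem IsUnionOfMinusculeOrbits.add_mem {P : RootPairing ι ℚ E N} {b : P.Base} {Ψ : Set E}
    (hΨ : IsUnionOfMinusculeOrbits b Ψ) {μ : E} (hμ : μ ∈ Ψ) {i : ι} (h : P.coroot' i μ = -1) :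
    μ + P.root i ∈ Ψ := by
  have := hΨ.reflection_mem hμ i
  rwa [RootPairing.reflection_apply, h, neg_one_smul, sub_neg_eq_add] at this

/-- If `(μ, α_i^∨) = 1`, then `μ - α_i` is again in `Ψ`. -/
theorem IsUnionOfMinusculeOrbits.sub_mem {P : RootPairing ι ℚ E N} {b : P.Base} {Ψ : Set E}
    (hΨ : IsUnionOfMinusculeOrbits b Ψ) {μ : E} (hμ : μ ∈ Ψ) {i : ι} (h : P.coroot' i μ = 1) :
    μ - P.root i ∈ Ψ := by
  have := hΨ.reflection_mem hμ i
  rwa [RootPairing.reflection_apply, h, one_smul] at this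

variable {V : Type*} [AddCommGroup V] [Module ℂ V] {Ψ : Set E}

open Classical in
/-- The basis vector `z_v` for `v` in `Ψ`; the value for `v` outside `Ψ` is irrelevant, since the
two theorems above show that the vectors `z_{μ ± α_i}` used below have their index in `Ψ`. -/
def basisVec (z : Basis Ψ ℂ V) (v : E) : V := if h : v ∈ Ψ then z ⟨v, h⟩ else 0

open Classical in
/-- `e_i (z_μ) = z_{μ + α_i}` if `(μ, α_i^∨) = -1`, and `0` otherwise. -/
def eOp (P : RootPairing ι ℚ E N) (z : Basis Ψ ℂ V) (i : ι) : End ℂ V :=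
  z.constr ℂ fun μ => if P.coroot' i (μ : E) = -1 then basisVec z (μ + P.root i) else 0

open Classical in
/-- `f_i (z_μ) = z_{μ - α_i}` if `(μ, α_i^∨) = 1`, and `0` otherwise. -/
def fOp (P : RootPairing ι ℚ E N) (z : Basis Ψ ℂ V) (i : ι) : End ℂ V :=
  z.constr ℂ fun μ => if P.coroot' i (μ : E) = 1 then basisVec z (μ - P.root i) else 0

theorem eOp_mul_self (P : RootPairing ι ℚ E N) (z : Basis Ψ ℂ V) (i : ι) :
    eOp P z i * eOp P z i = 0 := by
  refine z.ext fun μ => ?_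
  rw [Module.End.mul_apply]
  simp only [eOp, Basis.constr_basis, LinearMap.zero_apply]
  split_ifs with h
  · unfold basisVec
    split_ifs with hm
    · rw [Basis.constr_basis, if_neg]
      rw [map_add, h, RootPairing.root_coroot'_eq_pairing, RootPairing.pairing_same]
      norm_num
    · exact map_zero _
  · exact map_zero _

theorem fOp_mul_self (P : RootPairing ι ℚ E N) (z : Basis Ψ ℂ V) (i : ι) :
    fOp P z i * fOp P z i = 0 := by
  refine z.ext fun μ => ?_
  rw [Module.End.mul_apply]
  simp only [fOp, Basis.constr_basis, LinearMap.zero_apply]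
  split_ifs with h
  · unfold basisVec
    split_ifs with hm
    · rw [Basis.constr_basis, if_neg]
      rw [map_sub, h, RootPairing.root_coroot'_eq_pairing, RootPairing.pairing_same]
      norm_num
    · exact map_zero _
  · exact map_zero _

/-- For `a * a = 0`, the invertible map `id + t a`, whose inverse is `id - t a`. -/
def oneAddSmul (a : End ℂ V) (ha : a * a = 0) (t : ℂ) : LinearMap.GeneralLinearGroup ℂ V where
  val := 1 + t • a
  inv := 1 - t • a
  val_inv := by
    rw [add_mul, mul_sub, mul_sub, smul_mul_smul_comm, ha]; simp
  inv_val := by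
    rw [sub_mul, mul_add, mul_add, smul_mul_smul_comm, ha]; simp

/-- The element `n_i = (id + e_i)(id - f_i)(id + e_i)` of `GL(V)`. -/
def nOp (P : RootPairing ι ℚ E N) (z : Basis Ψ ℂ V) (i : ι) : LinearMap.GeneralLinearGroup ℂ V :=
  oneAddSmul (eOp P z i) (eOp_mul_self P z i) 1 * oneAddSmul (fOp P z i) (fOp_mul_self P z i) (-1) *
    oneAddSmul (eOp P z i) (eOp_mul_self P z i) 1

/-- `e` assigns to each root `α` an operator
`n_{i_1} ⋯ n_{i_k} e_i n_{i_k}⁻¹ ⋯ n_{i_1}⁻¹`, for some choice of simple indices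
`i, i_1, …, i_k` (with `k ≥ 0`) such that `α = s_{i_1} ⋯ s_{i_k} (α_i)`.
The values of `e` at vectors that are not roots are irrelevant. -/
def IsRootVectorChoice {P : RootPairing ι ℚ E N} (b : P.Base) (z : Basis Ψ ℂ V)
    (e : E → End ℂ V) : Prop :=
  ∀ α ∈ roots P, ∃ (i : b.support) (l : List b.support),
    α = (l.map fun j : b.support => P.reflection j.1).prod (P.root i) ∧
    e α = (l.map fun j : b.support => nOp P z j.1).prod.val * eOp P z i *
      (l.map fun j : b.support => nOp P z j.1).prod⁻¹.val

end MinusculeModel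

end

/-! Let `L` be the Lie algebra generated by the `e_i` and `f_i`, graded by weights: an operator has
weight `γ` if it sends each `z_μ` into the line of `z_{μ+γ}`. Two facts about `L` carry the proof.
Its nonzero weights are roots (`IsLieWeight.mem_range_root`), and its part of weight `α` is the line
of `𝐞_α` (`IsRootVectorChoice.isRootVector`). Hence `[𝐞_α, 𝐞_β]` is zero or a multiple of `𝐞_{α+β}`,
and only scalars remain to be found.

Both facts come from a triangular decomposition: `L` lies in the sum of the nested commutators of
the `e_i`, those of the `f_i`, and diagonal operators. This settles simple roots, because `[e_i,
e_i] = 0`. Conjugation by `n_i` is a product of exponentials of nilpotent `ad`'s, so it preserves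
`L`; it also permutes weights by `s_i`, which carries the statement to all roots. Other weights are
excluded by an induction on height using simple reflections.

For the scalars, each `𝐞_α` sends `z_μ` to `±z_{μ+α}` when `(μ, α^∨) = -1` and to `0` otherwise. A
nonzero minuscule weight excludes type G₂, so few pairs of Cartan numbers occur. If `(α, β) ≠ 0`,
exactly one of `𝐞_α 𝐞_β` and `𝐞_β 𝐞_α` acts on each relevant `z_μ`, which gives `±1`. If `(α, β) =
0`, the Jacobi identity with an opposite root vector gives `±2`. The triple products reduce to
counting values of `(μ, β^∨)`. -/

noncomputable section

namespace MinusculeModel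

attribute [local instance] LieRing.ofAssociativeRing

open Module

/-! ### Weight grading of the operators -/

section Grading

set_option linter.unusedSectionVars false

variable {E V : Type*} [AddCommGroup E] [Module ℚ E] [AddCommGroup V] [Module ℂ V] {Ψ : Set E}

theorem basisVec_of_mem (z : Basis Ψ ℂ V) {μ : E} (h : μ ∈ Ψ) : basisVec z μ = z ⟨μ, h⟩ :=
  dif_pos h

theorem basisVec_of_notMem (z : Basis Ψ ℂ V) {μ : E} (h : μ ∉ Ψ) : basisVec z μ = 0 :=
  dif_neg h

theorem basisVec_ne_zero (z : Basis Ψ ℂ V) {μ : E} (h : μ ∈ Ψ) : basisVec z μ ≠ 0 := by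
  rw [basisVec_of_mem z h]
  exact z.ne_zero _

theorem end_ext (z : Basis Ψ ℂ V) {X Y : End ℂ V}
    (h : ∀ μ ∈ Ψ, X (basisVec z μ) = Y (basisVec z μ)) : X = Y := by
  refine z.ext fun μ => ?_
  simpa [basisVec_of_mem z μ.2] using h μ μ.2

/-- The operators that raise weights by `γ`. -/
def shiftOps (z : Basis Ψ ℂ V) (γ : E) : Submodule ℂ (End ℂ V) where
  carrier := {X | ∀ μ ∈ Ψ, ∃ c : ℂ, X (basisVec z μ) = c • basisVec z (μ + γ)}
  zero_mem' := fun μ _ => ⟨0, by simp⟩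
  add_mem' := by
    intro X Y hX hY μ hμ
    obtain ⟨c, hc⟩ := hX μ hμ
    obtain ⟨d, hd⟩ := hY μ hμ
    exact ⟨c + d, by rw [LinearMap.add_apply, hc, hd, add_smul]⟩
  smul_mem' := by
    intro t X hX μ hμ
    obtain ⟨c, hc⟩ := hX μ hμ
    exact ⟨t * c, by rw [LinearMap.smul_apply, hc, mul_smul]⟩

theorem mul_mem_shiftOps {z : Basis Ψ ℂ V} {γ δ : E} {X Y : End ℂ V}
    (hX : X ∈ shiftOps z γ) (hY : Y ∈ shiftOps z δ) : X * Y ∈ shiftOps z (γ + δ) := by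
  intro μ hμ
  obtain ⟨d, hd⟩ := hY μ hμ
  by_cases h : μ + δ ∈ Ψ
  · obtain ⟨c, hc⟩ := hX _ h
    refine ⟨d * c, ?_⟩
    rw [Module.End.mul_apply, hd, map_smul, hc, smul_smul, add_assoc, add_comm δ]
  -- Here the default value `0` of `basisVec` outside `Ψ` matters.
  · exact ⟨0, by rw [Module.End.mul_apply, hd, basisVec_of_notMem z h]; simp⟩

theorem lie_mem_shiftOps {z : Basis Ψ ℂ V} {γ δ : E} {X Y : End ℂ V}
    (hX : X ∈ shiftOps z γ) (hY : Y ∈ shiftOps z δ) : ⁅X, Y⁆ ∈ shiftOps z (γ + δ) := by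
  rw [Ring.lie_def]
  refine sub_mem (mul_mem_shiftOps hX hY) ?_
  rw [add_comm]
  exact mul_mem_shiftOps hY hX

open Classical in
/-- The `ν`-th coordinate of a vector. -/
def coordAt (z : Basis Ψ ℂ V) (ν : E) : V →ₗ[ℂ] ℂ := if h : ν ∈ Ψ then z.coord ⟨ν, h⟩ else 0

theorem coordAt_self (z : Basis Ψ ℂ V) {ν : E} (h : ν ∈ Ψ) : coordAt z ν (basisVec z ν) = 1 := by
  simp [coordAt, h, basisVec_of_mem]

theorem coordAt_of_ne (z : Basis Ψ ℂ V) {μ ν : E} (h : μ ≠ ν) :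
    coordAt z ν (basisVec z μ) = 0 := by
  by_cases h1 : ν ∈ Ψ
  · by_cases h2 : μ ∈ Ψ
    · simp [coordAt, h1, basisVec_of_mem z h2, h]
    · simp [basisVec_of_notMem z h2]
  · simp [coordAt, h1]

/-- The component of weight `γ` of an operator. -/
def component (z : Basis Ψ ℂ V) (γ : E) : End ℂ V →ₗ[ℂ] End ℂ V where
  toFun X := z.constr ℂ fun μ => coordAt z (μ + γ) (X (z μ)) • basisVec z ((μ : E) + γ)
  map_add' X Y := z.ext fun μ => by simp [add_smul]
  map_smul' t X := z.ext fun μ => by simp [mul_smul]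

theorem component_apply (z : Basis Ψ ℂ V) (γ : E) (X : End ℂ V) {μ : E} (hμ : μ ∈ Ψ) :
    component z γ X (basisVec z μ) =
      coordAt z (μ + γ) (X (basisVec z μ)) • basisVec z (μ + γ) := by
  simp [component, basisVec_of_mem z hμ]

theorem component_of_mem {z : Basis Ψ ℂ V} {γ : E} {X : End ℂ V} (hX : X ∈ shiftOps z γ) :
    component z γ X = X := by
  refine end_ext z fun μ hμ => ?_
  obtain ⟨c, hc⟩ := hX μ hμ
  rw [component_apply z γ X hμ, hc]
  by_cases h : μ + γ ∈ Ψ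
  · simp [coordAt_self z h]
  · simp [basisVec_of_notMem z h]

theorem component_of_mem_of_ne {z : Basis Ψ ℂ V} {γ δ : E} {X : End ℂ V}
    (hX : X ∈ shiftOps z δ) (h : δ ≠ γ) : component z γ X = 0 := by
  refine end_ext z fun μ hμ => ?_
  obtain ⟨c, hc⟩ := hX μ hμ
  rw [component_apply z γ X hμ, hc, map_smul, coordAt_of_ne z (by simpa using h)]
  simp

/-- The diagonal operator `z_μ ↦ φ(μ) z_μ`. -/
def weightOp (z : Basis Ψ ℂ V) (φ : E →ₗ[ℚ] ℚ) : End ℂ V :=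
  z.constr ℂ fun μ => ((φ (μ : E) : ℚ) : ℂ) • z μ

theorem weightOp_apply (z : Basis Ψ ℂ V) (φ : E →ₗ[ℚ] ℚ) (μ : E) :
    weightOp z φ (basisVec z μ) = ((φ μ : ℚ) : ℂ) • basisVec z μ := by
  by_cases hμ : μ ∈ Ψ
  · simp [weightOp, basisVec_of_mem z hμ]
  · simp [basisVec_of_notMem z hμ]

theorem weightOp_mem_shiftOps (z : Basis Ψ ℂ V) (φ : E →ₗ[ℚ] ℚ) : weightOp z φ ∈ shiftOps z 0 :=
  fun μ _ => ⟨_, by rw [weightOp_apply, add_zero]⟩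

theorem weightOp_lie {z : Basis Ψ ℂ V} (φ : E →ₗ[ℚ] ℚ) {γ : E} {X : End ℂ V}
    (hX : X ∈ shiftOps z γ) : ⁅weightOp z φ, X⁆ = ((φ γ : ℚ) : ℂ) • X := by
  refine end_ext z fun μ hμ => ?_
  obtain ⟨c, hc⟩ := hX μ hμ
  rw [Ring.lie_def, LinearMap.sub_apply, Module.End.mul_apply, Module.End.mul_apply, weightOp_apply,
    map_smul, hc, map_smul, weightOp_apply, LinearMap.smul_apply, hc, map_add]
  push_cast
  module

/-- The span of the diagonal operators attached to linear forms. -/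
def weightOps (z : Basis Ψ ℂ V) : Submodule ℂ (End ℂ V) := Submodule.span ℂ (Set.range (weightOp z))

theorem lie_mem_span_of_mem_weightOps {z : Basis Ψ ℂ V} {γ : E} {X H : End ℂ V}
    (hX : X ∈ shiftOps z γ) (hH : H ∈ weightOps z) : ∃ c : ℂ, ⁅H, X⁆ = c • X := by
  induction hH using Submodule.span_induction with
  | mem H h =>
    obtain ⟨φ, rfl⟩ := h
    exact ⟨_, weightOp_lie φ hX⟩
  | zero => exact ⟨0, by simp⟩
  | add H K _ _ h k =>
    obtain ⟨c, hc⟩ := h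
    obtain ⟨d, hd⟩ := k
    exact ⟨c + d, by rw [add_lie, hc, hd, add_smul]⟩
  | smul t H _ h =>
    obtain ⟨c, hc⟩ := h
    exact ⟨t * c, by rw [smul_lie, hc, mul_smul]⟩

theorem weightOps_le_shiftOps (z : Basis Ψ ℂ V) : weightOps z ≤ shiftOps z 0 := by
  rw [weightOps, Submodule.span_le]
  rintro _ ⟨φ, rfl⟩
  exact weightOp_mem_shiftOps z φ

end Grading

/-! ### Triangular decomposition of the generated Lie algebra -/

section Triangular

set_option linter.unusedSectionVars false

variable {E V I : Type*} [AddCommGroup E] [Module ℚ E] [AddCommGroup V] [Module ℂ V] {Ψ : Set E}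

/-- Right-nested commutators of the operators `e i`, together with their weights, where `e i` has
weight `r i`. -/
inductive NestedLie (e : I → End ℂ V) (r : I → E) : E → End ℂ V → Prop
  | single (i : I) : NestedLie e r (r i) (e i)
  | lie (i : I) {γ : E} {X : End ℂ V} : NestedLie e r γ X → NestedLie e r (r i + γ) ⁅e i, X⁆

/-- The span of the right-nested commutators. -/
def nestedSpan (e : I → End ℂ V) (r : I → E) : Submodule ℂ (End ℂ V) :=
  Submodule.span ℂ {X | ∃ γ, NestedLie e r γ X}

theorem NestedLie.mem_shiftOps {z : Basis Ψ ℂ V} {e : I → End ℂ V} {r : I → E}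
    (he : ∀ i, e i ∈ shiftOps z (r i)) {γ : E} {X : End ℂ V} (hX : NestedLie e r γ X) :
    X ∈ shiftOps z γ := by
  induction hX with
  | single i => exact he i
  | lie i _ ih => exact lie_mem_shiftOps (he i) ih

theorem NestedLie.mem_nestedSpan {e : I → End ℂ V} {r : I → E} {γ : E} {X : End ℂ V}
    (hX : NestedLie e r γ X) : X ∈ nestedSpan e r :=
  Submodule.subset_span ⟨γ, hX⟩

theorem lie_mem_nestedSpan {e : I → End ℂ V} {r : I → E} (i : I) {X : End ℂ V}
    (hX : X ∈ nestedSpan e r) : ⁅e i, X⁆ ∈ nestedSpan e r := by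
  induction hX using Submodule.span_induction with
  | mem X h =>
    obtain ⟨γ, h⟩ := h
    exact (NestedLie.lie i h).mem_nestedSpan
  | zero => simp
  | add X Y _ _ h k => rw [lie_add]; exact add_mem h k
  | smul t X _ h => rw [lie_smul]; exact Submodule.smul_mem _ _ h

theorem lie_mem_of_mem_weightOps {z : Basis Ψ ℂ V} {e : I → End ℂ V} {r : I → E}
    (he : ∀ i, e i ∈ shiftOps z (r i)) (i : I) {H : End ℂ V} (hH : H ∈ weightOps z) :
    ⁅e i, H⁆ ∈ nestedSpan e r := by
  obtain ⟨c, hc⟩ := lie_mem_span_of_mem_weightOps (he i) hH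
  rw [← lie_skew, hc]
  exact neg_mem (Submodule.smul_mem _ _ (NestedLie.single i).mem_nestedSpan)

/-- Expand `[e_i, [f_j, X]] = [[e_i, f_j], X] + [f_j, [e_i, X]]`. In the first term a diagonal
operator scales `X`. The second is handled by induction, since bracketing a diagonal operator with
`f_j` only gives a multiple of `f_j`. -/
theorem lie_mem_nestedSpan_sup {z : Basis Ψ ℂ V} {e f : I → End ℂ V} {s : I → E}
    (hf : ∀ i, f i ∈ shiftOps z (s i))
    (hef : ∀ i j, ⁅e i, f j⁆ ∈ weightOps z) (i : I) {X : End ℂ V} (hX : X ∈ nestedSpan f s) :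
    ⁅e i, X⁆ ∈ nestedSpan f s ⊔ weightOps z := by
  induction hX using Submodule.span_induction with
  | mem X h =>
    obtain ⟨γ, h⟩ := h
    induction h with
    | single j => exact Submodule.mem_sup_right (hef i j)
    | @lie j γ X h ih =>
      rw [leibniz_lie]
      refine add_mem (Submodule.mem_sup_left ?_) (Submodule.mem_sup_left ?_)
      · obtain ⟨c, hc⟩ := lie_mem_span_of_mem_weightOps (h.mem_shiftOps hf) (hef i j)
        rw [hc]
        exact Submodule.smul_mem _ _ h.mem_nestedSpan
      · obtain ⟨Y, hY, H, hH, hYH⟩ := Submodule.mem_sup.1 ih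
        rw [← hYH, lie_add]
        exact add_mem (lie_mem_nestedSpan j hY) (lie_mem_of_mem_weightOps hf j hH)
  | zero => simp
  | add X Y _ _ h k => rw [lie_add]; exact add_mem h k
  | smul t X _ h => rw [lie_smul]; exact Submodule.smul_mem _ _ h

/-- The sum of the positive part, the negative part and the diagonal part. -/
def triangularSpan (z : Basis Ψ ℂ V) (e f : I → End ℂ V) (r : I → E) : Submodule ℂ (End ℂ V) :=
  nestedSpan e r ⊔ (nestedSpan f (-r) ⊔ weightOps z)

theorem lie_mem_triangularSpan {z : Basis Ψ ℂ V} {e f : I → End ℂ V} {r : I → E}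
    (he : ∀ i, e i ∈ shiftOps z (r i)) (hf : ∀ i, f i ∈ shiftOps z ((-r) i))
    (hef : ∀ i j, ⁅e i, f j⁆ ∈ weightOps z) (i : I) {X : End ℂ V}
    (hX : X ∈ triangularSpan z e f r) : ⁅e i, X⁆ ∈ triangularSpan z e f r := by
  obtain ⟨A, hA, B, hB, rfl⟩ := Submodule.mem_sup.1 hX
  obtain ⟨B, hB', C, hC, rfl⟩ := Submodule.mem_sup.1 hB
  rw [lie_add, lie_add]
  refine add_mem (Submodule.mem_sup_left (lie_mem_nestedSpan i hA)) (add_mem ?_ ?_)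
  · exact Submodule.mem_sup_right (lie_mem_nestedSpan_sup hf hef i hB')
  · exact Submodule.mem_sup_left (lie_mem_of_mem_weightOps he i hC)

theorem triangularSpan_swap (z : Basis Ψ ℂ V) (e f : I → End ℂ V) (r : I → E) :
    triangularSpan z f e (-r) = triangularSpan z e f r := by
  rw [triangularSpan, triangularSpan, neg_neg, ← sup_assoc, ← sup_assoc,
    sup_comm (nestedSpan e r)]

theorem lieSpan_le_triangularSpan {z : Basis Ψ ℂ V} {e f : I → End ℂ V} {r : I → E}
    (he : ∀ i, e i ∈ shiftOps z (r i)) (hf : ∀ i, f i ∈ shiftOps z ((-r) i))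
    (hef : ∀ i j, ⁅e i, f j⁆ ∈ weightOps z) {X : End ℂ V}
    (hX : X ∈ LieSubalgebra.lieSpan ℂ (End ℂ V) (Set.range e ∪ Set.range f)) :
    X ∈ triangularSpan z e f r := by
  have hfe : ∀ i j, ⁅f i, e j⁆ ∈ weightOps z := fun i j => by
    rw [← lie_skew]
    exact neg_mem (hef j i)
  -- Stability of the span under `ad X` is added to the claim. It passes from the generators to
  -- brackets by the Jacobi identity, so closure of the span under brackets need not be known
  -- beforehand.
  suffices X ∈ triangularSpan z e f r ∧
      ∀ Y ∈ triangularSpan z e f r, ⁅X, Y⁆ ∈ triangularSpan z e f r from this.1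
  induction hX using LieSubalgebra.lieSpan_induction with
  | mem X h =>
    obtain ⟨i, rfl⟩ | ⟨i, rfl⟩ := h
    · exact ⟨Submodule.mem_sup_left (NestedLie.single i).mem_nestedSpan,
        fun Y hY => lie_mem_triangularSpan he hf hef i hY⟩
    · refine ⟨Submodule.mem_sup_right (Submodule.mem_sup_left
        (NestedLie.single i).mem_nestedSpan), fun Y hY => ?_⟩
      rw [← triangularSpan_swap] at hY ⊢
      exact lie_mem_triangularSpan hf (by simpa using he) hfe i hY
  | zero => exact ⟨zero_mem _, fun Y _ => by rw [zero_lie]; exact zero_mem _⟩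
  | add X X' _ _ h h' =>
    exact ⟨add_mem h.1 h'.1, fun Y hY => by rw [add_lie]; exact add_mem (h.2 Y hY) (h'.2 Y hY)⟩
  | smul t X _ h =>
    exact ⟨Submodule.smul_mem _ _ h.1, fun Y hY => by
      rw [smul_lie]; exact Submodule.smul_mem _ _ (h.2 Y hY)⟩
  | lie X X' _ _ h h' =>
    exact ⟨h.2 X' h'.1, fun Y hY => by
      rw [lie_lie]; exact sub_mem (h.2 _ (h'.2 Y hY)) (h'.2 _ (h.2 Y hY))⟩

end Triangular

/-! ### Minuscule weights and relations between simple generators -/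

section Simple

set_option linter.unusedSectionVars false

variable {ι E N V : Type*} [AddCommGroup E] [Module ℚ E] [AddCommGroup N] [Module ℚ N]
  [AddCommGroup V] [Module ℂ V] {P : RootPairing ι ℚ E N} {Ψ : Set E}

/-- A set of weights which is stable under all reflections and whose elements pair with all
coroots to `0`, `1` or `-1`. -/
structure IsMinusculeSet (P : RootPairing ι ℚ E N) (Ψ : Set E) : Prop where
  reflection_mem : ∀ μ ∈ Ψ, ∀ i, P.reflection i μ ∈ Ψ
  coroot_mem : ∀ μ ∈ Ψ, ∀ i, P.coroot' i μ = 0 ∨ P.coroot' i μ = 1 ∨ P.coroot' i μ = -1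

theorem IsMinusculeSet.add_mem (hΨ : IsMinusculeSet P Ψ) {μ : E} (hμ : μ ∈ Ψ) {i : ι}
    (h : P.coroot' i μ = -1) : μ + P.root i ∈ Ψ := by
  have := hΨ.reflection_mem μ hμ i
  rwa [RootPairing.reflection_apply, h, neg_one_smul, sub_neg_eq_add] at this

theorem IsMinusculeSet.sub_mem (hΨ : IsMinusculeSet P Ψ) {μ : E} (hμ : μ ∈ Ψ) {i : ι}
    (h : P.coroot' i μ = 1) : μ - P.root i ∈ Ψ := by
  have := hΨ.reflection_mem μ hμ i
  rwa [RootPairing.reflection_apply, h, one_smul] at this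

theorem weylGroup_smul_coroot_mem (g : P.weylGroup) {S : Set ℚ} {μ : E}
    (hμ : ∀ i, P.coroot' i μ ∈ S) (i : ι) : P.coroot' i (g • μ) ∈ S := by
  obtain ⟨g, hg⟩ := g
  induction hg using RootPairing.weylGroup.induction generalizing μ i with
  | mem j =>
    have h : (⟨RootPairing.Equiv.reflection P j, P.reflection_mem_weylGroup j⟩ : P.weylGroup) • μ =
      P.reflection j μ := RootPairing.weylGroup.ofIdx_smul P j μ
    rw [h, RootPairing.coroot'_reflection]
    exact hμ _
  | one => simpa using hμ i
  | mul x y hx hy ihx ihy =>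
    rw [← Submonoid.mk_mul_mk _ _ _ hx hy, mul_smul]
    exact ihx (fun j => ihy hμ j) i

theorem weylGroup_smul_ne_zero (g : P.weylGroup) {μ : E} (hμ : μ ≠ 0) : g • μ ≠ 0 := by
  intro h
  apply hμ
  have h2 : g⁻¹ • (g • μ) = g⁻¹ • (0 : E) := by rw [h]
  rwa [inv_smul_smul, smul_zero] at h2

theorem IsUnionOfMinusculeOrbits.isMinusculeSet {b : P.Base}
    (hΨ : IsUnionOfMinusculeOrbits b Ψ) : IsMinusculeSet P Ψ := by
  refine ⟨fun μ hμ i => hΨ.reflection_mem hμ i, fun μ hμ i => ?_⟩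
  obtain ⟨-, S, hS, rfl⟩ := hΨ
  simp only [Set.mem_iUnion] at hμ
  obtain ⟨v, hv, g, rfl⟩ := hμ
  simpa using weylGroup_smul_coroot_mem g (hS v hv).pairing_mem i

theorem IsUnionOfMinusculeOrbits.exists_ne_zero {b : P.Base}
    (hΨ : IsUnionOfMinusculeOrbits b Ψ) : ∃ μ ∈ Ψ, μ ≠ 0 := by
  obtain ⟨⟨μ, hμ⟩, S, hS, rfl⟩ := hΨ
  refine ⟨μ, hμ, ?_⟩
  simp only [Set.mem_iUnion] at hμ
  obtain ⟨v, hv, g, rfl⟩ := hμ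
  exact weylGroup_smul_ne_zero g (hS v hv).ne_zero

theorem eOp_apply_of_eq (z : Basis Ψ ℂ V) {i : ι} {μ : E} (hμ : μ ∈ Ψ) (h : P.coroot' i μ = -1) :
    eOp P z i (basisVec z μ) = basisVec z (μ + P.root i) := by
  rw [basisVec_of_mem z hμ, eOp, Basis.constr_basis, if_pos h]

theorem eOp_apply_of_ne (z : Basis Ψ ℂ V) {i : ι} {μ : E} (hμ : μ ∈ Ψ) (h : P.coroot' i μ ≠ -1) :
    eOp P z i (basisVec z μ) = 0 := by
  rw [basisVec_of_mem z hμ, eOp, Basis.constr_basis, if_neg h]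

theorem fOp_apply_of_eq (z : Basis Ψ ℂ V) {i : ι} {μ : E} (hμ : μ ∈ Ψ) (h : P.coroot' i μ = 1) :
    fOp P z i (basisVec z μ) = basisVec z (μ - P.root i) := by
  rw [basisVec_of_mem z hμ, fOp, Basis.constr_basis, if_pos h]

theorem fOp_apply_of_ne (z : Basis Ψ ℂ V) {i : ι} {μ : E} (hμ : μ ∈ Ψ) (h : P.coroot' i μ ≠ 1) :
    fOp P z i (basisVec z μ) = 0 := by
  rw [basisVec_of_mem z hμ, fOp, Basis.constr_basis, if_neg h]

theorem eOp_mem_shiftOps (z : Basis Ψ ℂ V) (i : ι) : eOp P z i ∈ shiftOps z (P.root i) := by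
  intro μ hμ
  by_cases h : P.coroot' i μ = -1
  · exact ⟨1, by rw [eOp_apply_of_eq z hμ h, one_smul]⟩
  · exact ⟨0, by rw [eOp_apply_of_ne z hμ h, zero_smul]⟩

theorem fOp_mem_shiftOps (z : Basis Ψ ℂ V) (i : ι) : fOp P z i ∈ shiftOps z (-P.root i) := by
  intro μ hμ
  by_cases h : P.coroot' i μ = 1
  · exact ⟨1, by rw [fOp_apply_of_eq z hμ h, one_smul, sub_eq_add_neg]⟩
  · exact ⟨0, by rw [fOp_apply_of_ne z hμ h, zero_smul]⟩

theorem coroot'_root_self (i : ι) : P.coroot' i (P.root i) = 2 := by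
  rw [RootPairing.root_coroot'_eq_pairing, RootPairing.pairing_same]

theorem eOp_lie_fOp_self (hΨ : IsMinusculeSet P Ψ) (z : Basis Ψ ℂ V) (i : ι) :
    ⁅eOp P z i, fOp P z i⁆ = weightOp z (P.coroot' i) := by
  refine end_ext z fun μ hμ => ?_
  rw [Ring.lie_def, LinearMap.sub_apply, Module.End.mul_apply, Module.End.mul_apply, weightOp_apply]
  obtain h | h | h := hΨ.coroot_mem μ hμ i
  · rw [fOp_apply_of_ne z hμ (by rw [h]; norm_num), eOp_apply_of_ne z hμ (by rw [h]; norm_num), h]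
    simp
  · rw [fOp_apply_of_eq z hμ h, eOp_apply_of_ne z hμ (by rw [h]; norm_num),
      eOp_apply_of_eq z (hΨ.sub_mem hμ h) (by rw [map_sub, h, coroot'_root_self]; norm_num), h]
    simp
  · rw [eOp_apply_of_eq z hμ h, fOp_apply_of_ne z hμ (by rw [h]; norm_num),
      fOp_apply_of_eq z (hΨ.add_mem hμ h) (by rw [map_add, h, coroot'_root_self]; norm_num), h]
    simp

/-- As pairings of weights lie in `{0, ±1}`, either product can be nonzero on `z_μ` only if `(μ,
α_i^∨) = -1`, `(μ, α_j^∨) = 1` and the two roots are orthogonal. Then both products give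
`z_{μ+α_i-α_j}`. -/
theorem eOp_lie_fOp_of_pairing_nonpos (hΨ : IsMinusculeSet P Ψ) (z : Basis Ψ ℂ V) {i j : ι}
    (hij : P.pairing i j ≤ 0) (hji : P.pairing j i ≤ 0) : ⁅eOp P z i, fOp P z j⁆ = 0 := by
  refine end_ext z fun μ hμ => ?_
  rw [Ring.lie_def, LinearMap.sub_apply, Module.End.mul_apply, Module.End.mul_apply,
    LinearMap.zero_apply]
  have hsub : P.coroot' i (μ - P.root j) = P.coroot' i μ - P.pairing j i := by
    rw [map_sub, RootPairing.root_coroot'_eq_pairing]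
  have hadd : P.coroot' j (μ + P.root i) = P.coroot' j μ + P.pairing i j := by
    rw [map_add, RootPairing.root_coroot'_eq_pairing]
  have hi : -1 ≤ P.coroot' i μ := by
    obtain h | h | h := hΨ.coroot_mem μ hμ i <;> rw [h] <;> norm_num
  have hj : P.coroot' j μ ≤ 1 := by
    obtain h | h | h := hΨ.coroot_mem μ hμ j <;> rw [h] <;> norm_num
  by_cases h1 : P.coroot' j μ = 1
  · have hm := hΨ.sub_mem hμ h1
    rw [fOp_apply_of_eq z hμ h1]
    by_cases h2 : P.coroot' i μ = -1
    · have hp := hΨ.add_mem hμ h2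
      rw [eOp_apply_of_eq z hμ h2]
      by_cases h3 : P.pairing j i = 0
      · have h4 : P.pairing i j = 0 := by
          rwa [RootPairing.pairing_eq_zero_iff']
        rw [eOp_apply_of_eq z hm (by rw [hsub, h2, h3, sub_zero]),
          fOp_apply_of_eq z hp (by rw [hadd, h1, h4, add_zero])]
        rw [sub_add_eq_add_sub, sub_self]
      · have h4 : P.pairing i j ≠ 0 := by
          rwa [Ne, RootPairing.pairing_eq_zero_iff']
        rw [eOp_apply_of_ne z hm, fOp_apply_of_ne z hp, sub_self]
        · rw [hadd, h1]
          simpa using h4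
        · rw [hsub, h2]
          simpa using h3
    · rw [eOp_apply_of_ne z hμ h2, eOp_apply_of_ne z hm, map_zero, sub_zero]
      rw [hsub]
      intro h
      apply h2
      linarith
  · rw [fOp_apply_of_ne z hμ h1, map_zero, zero_sub, neg_eq_zero]
    by_cases h2 : P.coroot' i μ = -1
    · rw [eOp_apply_of_eq z hμ h2, fOp_apply_of_ne z (hΨ.add_mem hμ h2)]
      rw [hadd]
      intro h
      apply h1
      linarith
    · rw [eOp_apply_of_ne z hμ h2, map_zero]

/-- The Lie algebra generated by the operators `e_i` and `f_i`. -/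
def rootLie (b : P.Base) (z : Basis Ψ ℂ V) : LieSubalgebra ℂ (End ℂ V) :=
  LieSubalgebra.lieSpan ℂ (End ℂ V)
    (Set.range (fun i : b.support => eOp P z i) ∪ Set.range fun i : b.support => fOp P z i)

theorem eOp_mem_rootLie (b : P.Base) (z : Basis Ψ ℂ V) (i : b.support) :
    eOp P z i ∈ rootLie b z :=
  LieSubalgebra.subset_lieSpan (Or.inl ⟨i, rfl⟩)

theorem fOp_mem_rootLie (b : P.Base) (z : Basis Ψ ℂ V) (i : b.support) :
    fOp P z i ∈ rootLie b z :=
  LieSubalgebra.subset_lieSpan (Or.inr ⟨i, rfl⟩)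

variable [Finite ι] [P.IsCrystallographic]

theorem eOp_lie_fOp_of_ne (hΨ : IsMinusculeSet P Ψ) (b : P.Base) (z : Basis Ψ ℂ V)
    {i j : b.support} (hij : i ≠ j) : ⁅eOp P z i, fOp P z j⁆ = 0 := by
  have key : ∀ k l : b.support, k ≠ l → P.pairing k l ≤ 0 := fun k l hkl => by
    have := b.pairingIn_le_zero_of_ne (fun h => hkl (Subtype.ext h)) k.2 l.2
    rw [← P.algebraMap_pairingIn ℤ]
    simpa using this
  exact eOp_lie_fOp_of_pairing_nonpos hΨ z (key i j hij) (key j i hij.symm)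

theorem eOp_lie_fOp_mem (hΨ : IsMinusculeSet P Ψ) (b : P.Base) (z : Basis Ψ ℂ V)
    (i j : b.support) : ⁅eOp P z i, fOp P z j⁆ ∈ weightOps z := by
  by_cases hij : i = j
  · subst hij
    rw [eOp_lie_fOp_self hΨ z]
    exact Submodule.subset_span ⟨_, rfl⟩
  · rw [eOp_lie_fOp_of_ne hΨ b z hij]
    exact zero_mem _

theorem rootLie_le_triangularSpan (hΨ : IsMinusculeSet P Ψ) (b : P.Base) (z : Basis Ψ ℂ V)
    {X : End ℂ V} (hX : X ∈ rootLie b z) :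
    X ∈ triangularSpan z (fun i : b.support => eOp P z i) (fun i : b.support => fOp P z i)
      fun i : b.support => P.root i :=
  lieSpan_le_triangularSpan (fun _ => eOp_mem_shiftOps z _) (fun _ => fOp_mem_shiftOps z _)
    (eOp_lie_fOp_mem hΨ b z) hX

end Simple

/-! ### Weights of the triangular span -/

section Weights

set_option linter.unusedSectionVars false

variable {E V I : Type*} [Fintype I] [AddCommGroup E] [Module ℚ E] [AddCommGroup V] [Module ℂ V]
  {Ψ : Set E}

/-- `γ` is a combination of the `r i` with coefficients in `ℕ`, at least two of which are
positive. -/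
def IsMixedSum (r : I → E) (γ : E) : Prop :=
  ∃ n : I → ℕ, γ = ∑ i, n i • r i ∧ ∃ i j, i ≠ j ∧ 0 < n i ∧ 0 < n j

theorem isMixedSum_neg {r : I → E} {γ : E} : IsMixedSum (-r) γ ↔ IsMixedSum r (-γ) := by
  refine exists_congr fun n => and_congr_left fun _ => ?_
  rw [neg_eq_iff_eq_neg, ← Finset.sum_neg_distrib]
  simp

/-- A longer commutator begins, at its innermost place, with some `[e_i, e_j]`: it vanishes for `i =
j`, and otherwise two distinct indices occur from there on. -/
theorem NestedLie.weight {e : I → End ℂ V} {r : I → E} {γ : E} {X : End ℂ V}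
    (hX : NestedLie e r γ X) : (∃ i, γ = r i ∧ X = e i) ∨ X = 0 ∨ IsMixedSum r γ := by
  classical
  induction hX with
  | single i => exact Or.inl ⟨i, rfl, rfl⟩
  | @lie i γ X _ ih =>
    right
    obtain ⟨j, rfl, rfl⟩ | rfl | ⟨n, rfl, k, l, hkl, hk, hl⟩ := ih
    · by_cases hij : i = j
      · left
        rw [hij, lie_self]
      · right
        refine ⟨Pi.single i 1 + Pi.single j 1, ?_, i, j, hij, by simp, by simp⟩
        simp [add_smul, Finset.sum_add_distrib, Pi.single_apply]
    · exact Or.inl (lie_zero _)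
    · right
      refine ⟨Pi.single i 1 + n, ?_, k, l, hkl, by simp [hk], by simp [hl]⟩
      simp [add_smul, Finset.sum_add_distrib, Pi.single_apply]

theorem IsMixedSum.ne {r : I → E} (hr : LinearIndependent ℚ r) {γ : E} (hγ : IsMixedSum r γ)
    (i : I) (t : ℚ) : γ ≠ t • r i := by
  classical
  obtain ⟨n, rfl, k, l, hkl, hk, hl⟩ := hγ
  intro h
  have h2 : ∑ j, ((n j : ℚ) - Pi.single (M := fun _ => ℚ) i t j) • r j = 0 := by
    simp [sub_smul, Finset.sum_sub_distrib, Pi.single_apply, ← h, Nat.cast_smul_eq_nsmul]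
  have h3 := Fintype.linearIndependent_iff.1 hr _ h2
  have : ∀ m, m ≠ i → n m = 0 := fun m hm => by simpa [hm] using h3 m
  by_cases hki : k = i
  · exact hl.ne' (this l fun h => hkl (hki.trans h.symm))
  · exact hk.ne' (this k hki)

theorem component_nestedSpan {z : Basis Ψ ℂ V} {e : I → End ℂ V} {r : I → E}
    (he : ∀ i, e i ∈ shiftOps z (r i)) {X : End ℂ V} (hX : X ∈ nestedSpan e r) {γ : E}
    (h0 : component z γ X ≠ 0) : (∃ i, γ = r i) ∨ IsMixedSum r γ := by
  by_contra! h
  apply h0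
  induction hX using Submodule.span_induction with
  | mem X hX =>
    obtain ⟨δ, hX⟩ := hX
    by_cases hδ : δ = γ
    · subst hδ
      obtain ⟨i, hi, -⟩ | rfl | hm := hX.weight
      · exact absurd hi (h.1 i)
      · exact map_zero _
      · exact absurd hm h.2
    · exact component_of_mem_of_ne (hX.mem_shiftOps he) hδ
  | zero => exact map_zero _
  | add X Y _ _ hX hY =>
    by_contra hne
    rw [map_add] at hne
    by_cases h1 : component z γ X = 0
    · by_cases h2 : component z γ Y = 0
      · exact hne (by rw [h1, h2, add_zero])
      · exact h2 (hY h2)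
    · exact h1 (hX h1)
  | smul t X _ hX =>
    by_contra hne
    rw [map_smul] at hne
    by_cases h1 : component z γ X = 0
    · exact hne (by rw [h1, smul_zero])
    · exact h1 (hX h1)

theorem component_nestedSpan_self {z : Basis Ψ ℂ V} {e : I → End ℂ V} {r : I → E}
    (hr : LinearIndependent ℚ r)
    (he : ∀ i, e i ∈ shiftOps z (r i)) {X : End ℂ V} (hX : X ∈ nestedSpan e r) (i : I) :
    ∃ c : ℂ, component z (r i) X = c • e i := by
  induction hX using Submodule.span_induction with
  | mem X hX =>
    obtain ⟨δ, hX⟩ := hX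
    by_cases hδ : δ = r i
    · subst hδ
      obtain ⟨j, hj, rfl⟩ | rfl | hm := hX.weight
      · rw [hr.injective hj, component_of_mem (he j)]
        exact ⟨1, (one_smul _ _).symm⟩
      · exact ⟨0, by simp⟩
      · exact absurd (one_smul ℚ _).symm (hm.ne hr i 1)
    · exact ⟨0, by rw [component_of_mem_of_ne (hX.mem_shiftOps he) hδ, zero_smul]⟩
  | zero => exact ⟨0, by simp⟩
  | add X Y _ _ h k =>
    obtain ⟨c, hc⟩ := h
    obtain ⟨d, hd⟩ := k
    exact ⟨c + d, by rw [map_add, hc, hd, add_smul]⟩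
  | smul t X _ h =>
    obtain ⟨c, hc⟩ := h
    exact ⟨t * c, by rw [map_smul, hc, mul_smul]⟩

/-- Project to weight `r i`. By linear independence the negative and diagonal parts do not
contribute, and the only nonzero nested commutator of that weight is `e i`. -/
theorem eq_smul_of_mem_triangularSpan {z : Basis Ψ ℂ V} {e f : I → End ℂ V} {r : I → E}
    (hr : LinearIndependent ℚ r) (he : ∀ i, e i ∈ shiftOps z (r i))
    (hf : ∀ i, f i ∈ shiftOps z ((-r) i)) {X : End ℂ V} (hX : X ∈ triangularSpan z e f r) {i : I}
    (hXi : X ∈ shiftOps z (r i)) : ∃ c : ℂ, X = c • e i := by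
  obtain ⟨A, hA, B, hB, rfl⟩ := Submodule.mem_sup.1 hX
  obtain ⟨B, hB', C, hC, rfl⟩ := Submodule.mem_sup.1 hB
  obtain ⟨c, hc⟩ := component_nestedSpan_self hr he hA i
  refine ⟨c, ?_⟩
  classical
  have hB0 : component z (r i) B = 0 := by
    by_contra h
    obtain ⟨j, hj⟩ | hm := component_nestedSpan hf hB' h
    · have h1 := Fintype.linearIndependent_iff.1 hr (Pi.single i 1 + Pi.single j 1)
        (by simp [add_smul, Finset.sum_add_distrib, Pi.single_apply, hj]) i
      simp only [Pi.add_apply, Pi.single_apply, if_true] at h1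
      split_ifs at h1 <;> norm_num at h1
    · rw [isMixedSum_neg] at hm
      exact hm.ne hr i (-1) (by simp)
  have hC0 : component z (r i) C = 0 :=
    component_of_mem_of_ne (weightOps_le_shiftOps z hC) (hr.ne_zero i).symm
  rw [← component_of_mem hXi, map_add, map_add, hc, hB0, hC0, add_zero, add_zero]

theorem weight_of_mem_triangularSpan {z : Basis Ψ ℂ V} {e f : I → End ℂ V} {r : I → E}
    (he : ∀ i, e i ∈ shiftOps z (r i))
    (hf : ∀ i, f i ∈ shiftOps z ((-r) i)) {X : End ℂ V} (hX : X ∈ triangularSpan z e f r)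
    (h0 : X ≠ 0) {γ : E} (hXγ : X ∈ shiftOps z γ) :
    γ = 0 ∨ (∃ i, γ = r i) ∨ (∃ i, γ = - r i) ∨ IsMixedSum r γ ∨ IsMixedSum r (-γ) := by
  obtain ⟨A, hA, B, hB, rfl⟩ := Submodule.mem_sup.1 hX
  obtain ⟨B, hB', C, hC, rfl⟩ := Submodule.mem_sup.1 hB
  rw [← component_of_mem hXγ, map_add, map_add] at h0
  by_cases hA0 : component z γ A = 0
  · by_cases hB0 : component z γ B = 0
    · left
      by_contra hγ
      rw [hA0, hB0, component_of_mem_of_ne (weightOps_le_shiftOps z hC) (Ne.symm hγ)] at h0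
      simp at h0
    · obtain h | h := component_nestedSpan hf hB' hB0
      · exact Or.inr (Or.inr (Or.inl h))
      · exact Or.inr (Or.inr (Or.inr (Or.inr (isMixedSum_neg.1 h))))
  · obtain h | h := component_nestedSpan he hA hA0
    · exact Or.inr (Or.inl h)
    · exact Or.inr (Or.inr (Or.inr (Or.inl h)))

end Weights

/-! ### Root vectors and conjugation by the `n_i` -/

section RootVectors

set_option linter.unusedSectionVars false

variable {ι E N V : Type*} [AddCommGroup E] [Module ℚ E] [AddCommGroup N] [Module ℚ N]
  [AddCommGroup V] [Module ℂ V] {P : RootPairing ι ℚ E N} {Ψ : Set E}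

theorem reflection_reflection (i : ι) (v : E) : P.reflection i (P.reflection i v) = v := by
  simp

theorem IsMinusculeSet.reflection_mem_iff (hΨ : IsMinusculeSet P Ψ) {μ : E} {i : ι} :
    P.reflection i μ ∈ Ψ ↔ μ ∈ Ψ :=
  ⟨fun h => by simpa using hΨ.reflection_mem _ h i, fun h => hΨ.reflection_mem _ h i⟩

/-- The operator maps each basis vector `z_μ` to plus or minus `z_{s_i(μ)}`. -/
def IsSignedReflection (P : RootPairing ι ℚ E N) (z : Basis Ψ ℂ V) (i : ι) (g : End ℂ V) : Prop :=
  ∀ μ, ∃ s : ℂ, (s = 1 ∨ s = -1) ∧ g (basisVec z μ) = s • basisVec z (P.reflection i μ)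

theorem oneAddSmul_apply (a : End ℂ V) (ha : a * a = 0) (t : ℂ) (v : V) :
    (oneAddSmul a ha t).val v = v + t • a v := by
  simp [oneAddSmul]

theorem oneAddSmul_inv (a : End ℂ V) (ha : a * a = 0) (t : ℂ) :
    (oneAddSmul a ha t)⁻¹ = oneAddSmul a ha (-t) := by
  ext1
  change 1 - t • a = 1 + (-t) • a
  rw [neg_smul, sub_eq_add_neg]

theorem nOp_apply (z : Basis Ψ ℂ V) (i : ι) (v : V) :
    (nOp P z i).val v = (v + eOp P z i v) - fOp P z i (v + eOp P z i v) +
      eOp P z i ((v + eOp P z i v) - fOp P z i (v + eOp P z i v)) := by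
  simp only [nOp, Units.val_mul, Module.End.mul_apply, oneAddSmul_apply, one_smul, neg_smul,
    ← sub_eq_add_neg]

theorem nOp_isSignedReflection (hΨ : IsMinusculeSet P Ψ) (z : Basis Ψ ℂ V) (i : ι) :
    IsSignedReflection P z i (nOp P z i).val := by
  intro μ
  by_cases hμ : μ ∈ Ψ
  · rw [nOp_apply, RootPairing.reflection_apply]
    obtain h | h | h := hΨ.coroot_mem μ hμ i
    · refine ⟨1, Or.inl rfl, ?_⟩
      rw [eOp_apply_of_ne z hμ (by rw [h]; norm_num), add_zero,
        fOp_apply_of_ne z hμ (by rw [h]; norm_num), sub_zero,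
        eOp_apply_of_ne z hμ (by rw [h]; norm_num), h]
      simp
    · refine ⟨-1, Or.inr rfl, ?_⟩
      rw [eOp_apply_of_ne z hμ (by rw [h]; norm_num), add_zero,
        fOp_apply_of_eq z hμ h, map_sub, eOp_apply_of_ne z hμ (by rw [h]; norm_num),
        eOp_apply_of_eq z (hΨ.sub_mem hμ h) (by rw [map_sub, h, coroot'_root_self]; norm_num), h]
      simp only [one_smul, neg_smul, sub_add_cancel]
      abel
    · refine ⟨1, Or.inl rfl, ?_⟩
      have hp := hΨ.add_mem hμ h
      have hv : P.coroot' i (μ + P.root i) = 1 := by rw [map_add, h, coroot'_root_self]; norm_num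
      rw [eOp_apply_of_eq z hμ h, map_add, fOp_apply_of_ne z hμ (by rw [h]; norm_num),
        fOp_apply_of_eq z hp hv, add_sub_cancel_right, zero_add, add_sub_cancel_left,
        eOp_apply_of_ne z hp (by rw [hv]; norm_num), h]
      simp
  · refine ⟨1, Or.inl rfl, ?_⟩
    rw [basisVec_of_notMem z hμ, basisVec_of_notMem z (by rwa [hΨ.reflection_mem_iff])]
    simp

theorem IsSignedReflection.inv {z : Basis Ψ ℂ V} {i : ι} {g : LinearMap.GeneralLinearGroup ℂ V}
    (hg : IsSignedReflection P z i g.val) : IsSignedReflection P z i g⁻¹.val := by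
  intro μ
  obtain ⟨s, hs, h⟩ := hg (P.reflection i μ)
  refine ⟨s, hs, ?_⟩
  rw [reflection_reflection] at h
  have h2 : g⁻¹.val (g.val (basisVec z (P.reflection i μ))) = basisVec z (P.reflection i μ) := by
    rw [← Module.End.mul_apply, Units.inv_mul, Module.End.one_apply]
  rw [h, map_smul] at h2
  rw [← h2, smul_smul]
  obtain rfl | rfl := hs <;> simp

theorem IsSignedReflection.mul_mul_mem_shiftOps (hΨ : IsMinusculeSet P Ψ) {z : Basis Ψ ℂ V} {i : ι}
    {g g' X : End ℂ V} (hg : IsSignedReflection P z i g) (hg' : IsSignedReflection P z i g')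
    {γ : E} (hX : X ∈ shiftOps z γ) : g * X * g' ∈ shiftOps z (P.reflection i γ) := by
  intro μ hμ
  obtain ⟨s, -, hs⟩ := hg' μ
  obtain ⟨c, hc⟩ := hX _ (hΨ.reflection_mem μ hμ i)
  obtain ⟨t, -, ht⟩ := hg (P.reflection i μ + γ)
  refine ⟨s * c * t, ?_⟩
  rw [Module.End.mul_apply, Module.End.mul_apply, hs, map_smul, hc, map_smul, map_smul, ht,
    map_add, reflection_reflection, smul_smul, smul_smul]

/-- The operator maps `z_μ` to plus or minus `z_{μ + α}` if `φ(μ) = -1`, and to `0` otherwise. -/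
structure IsSignedShift (z : Basis Ψ ℂ V) (φ : E →ₗ[ℚ] ℚ) (α : E) (X : End ℂ V) : Prop where
  apply_of_eq : ∀ μ ∈ Ψ, φ μ = -1 →
    ∃ s : ℂ, (s = 1 ∨ s = -1) ∧ X (basisVec z μ) = s • basisVec z (μ + α)
  apply_of_ne : ∀ μ ∈ Ψ, φ μ ≠ -1 → X (basisVec z μ) = 0

theorem IsSignedShift.mem_shiftOps {z : Basis Ψ ℂ V} {φ : E →ₗ[ℚ] ℚ} {α : E} {X : End ℂ V}
    (hX : IsSignedShift z φ α X) : X ∈ shiftOps z α := by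
  intro μ hμ
  by_cases h : φ μ = -1
  · obtain ⟨s, -, hs⟩ := hX.apply_of_eq μ hμ h
    exact ⟨s, hs⟩
  · exact ⟨0, by rw [hX.apply_of_ne μ hμ h, zero_smul]⟩

theorem IsSignedReflection.mul_mul_isSignedShift (hΨ : IsMinusculeSet P Ψ) {z : Basis Ψ ℂ V} {i : ι}
    {g g' X : End ℂ V} (hg : IsSignedReflection P z i g) (hg' : IsSignedReflection P z i g')
    {φ : E →ₗ[ℚ] ℚ} {α : E} (hX : IsSignedShift z φ α X) :
    IsSignedShift z (φ ∘ₗ (P.reflection i).toLinearMap) (P.reflection i α) (g * X * g') := by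
  refine ⟨fun μ hμ h => ?_, fun μ hμ h => ?_⟩
  · obtain ⟨s, hs, hsμ⟩ := hg' μ
    obtain ⟨c, hc, hcμ⟩ := hX.apply_of_eq _ (hΨ.reflection_mem μ hμ i) h
    obtain ⟨t, ht, htμ⟩ := hg (P.reflection i μ + α)
    refine ⟨s * c * t, ?_, ?_⟩
    · obtain rfl | rfl := hs <;> obtain rfl | rfl := hc <;> obtain rfl | rfl := ht <;> norm_num
    · rw [Module.End.mul_apply, Module.End.mul_apply, hsμ, map_smul, hcμ, map_smul, map_smul, htμ,
        map_add, reflection_reflection, smul_smul, smul_smul]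
  · obtain ⟨s, hs, hsμ⟩ := hg' μ
    rw [Module.End.mul_apply, Module.End.mul_apply, hsμ, map_smul,
      hX.apply_of_ne _ (hΨ.reflection_mem μ hμ i) h, smul_zero, map_zero]

theorem IsSignedReflection.mul_weightOp_mul {z : Basis Ψ ℂ V} {i : ι}
    {g : LinearMap.GeneralLinearGroup ℂ V} (hg : IsSignedReflection P z i g.val)
    (φ : E →ₗ[ℚ] ℚ) :
    g.val * weightOp z φ * g⁻¹.val = weightOp z (φ ∘ₗ (P.reflection i).toLinearMap) := by
  refine end_ext z fun μ hμ => ?_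
  obtain ⟨s, -, hs⟩ := hg.inv μ
  have h2 : g.val (g⁻¹.val (basisVec z μ)) = basisVec z μ := by
    rw [← Module.End.mul_apply, Units.mul_inv, Module.End.one_apply]
  rw [Module.End.mul_apply, Module.End.mul_apply, hs, map_smul, weightOp_apply, smul_comm,
    map_smul, ← hs, h2, weightOp_apply]
  simp

theorem lie_lie_of_mul_self {a : End ℂ V} (ha : a * a = 0) (X : End ℂ V) :
    ⁅a, ⁅a, X⁆⁆ = (-2 : ℂ) • (a * X * a) := by
  have h : a * (a * X) = 0 := by rw [← mul_assoc, ha, zero_mul]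
  simp only [Ring.lie_def, mul_sub, sub_mul, mul_assoc, ha, h, mul_zero]
  module

/-- Since `a * a = 0`, conjugation by `1 + t a = exp(t a)` is `exp(t ad a)`, and the series stops
after the quadratic term. -/
theorem oneAddSmul_conj_mem {L : LieSubalgebra ℂ (End ℂ V)} {a : End ℂ V} (ha : a * a = 0)
    (haL : a ∈ L) (t : ℂ) {X : End ℂ V} (hX : X ∈ L) :
    (oneAddSmul a ha t).val * X * (oneAddSmul a ha t)⁻¹.val ∈ L := by
  have h : (oneAddSmul a ha t).val * X * (oneAddSmul a ha t)⁻¹.val =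
      X + t • ⁅a, X⁆ + (t ^ 2 / 2) • ⁅a, ⁅a, X⁆⁆ := by
    rw [lie_lie_of_mul_self ha, Ring.lie_def]
    change (1 + t • a) * X * (1 - t • a) = _
    simp only [add_mul, mul_sub, one_mul, mul_one, smul_mul_assoc, mul_smul_comm]
    module
  rw [h]
  exact add_mem (add_mem hX (L.smul_mem _ (L.lie_mem haL hX)))
    (L.smul_mem _ (L.lie_mem haL (L.lie_mem haL hX)))

theorem oneAddSmul_inv_conj_mem {L : LieSubalgebra ℂ (End ℂ V)} {a : End ℂ V} (ha : a * a = 0)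
    (haL : a ∈ L) (t : ℂ) {X : End ℂ V} (hX : X ∈ L) :
    (oneAddSmul a ha t)⁻¹.val * X * (oneAddSmul a ha t).val ∈ L := by
  have := oneAddSmul_conj_mem ha haL (-t) hX
  rwa [oneAddSmul_inv, neg_neg, ← oneAddSmul_inv] at this

theorem nOp_conj_mem (b : P.Base) (z : Basis Ψ ℂ V) (i : b.support) {X : End ℂ V}
    (hX : X ∈ rootLie b z) : (nOp P z i).val * X * (nOp P z i)⁻¹.val ∈ rootLie b z := by
  have he := eOp_mem_rootLie b z i
  have hf := fOp_mem_rootLie b z i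
  have := oneAddSmul_conj_mem (eOp_mul_self P z i) he 1 <|
    oneAddSmul_conj_mem (fOp_mul_self P z i) hf (-1) <|
    oneAddSmul_conj_mem (eOp_mul_self P z i) he 1 hX
  simpa only [nOp, mul_inv_rev, Units.val_mul, mul_assoc] using this

theorem nOp_inv_conj_mem (b : P.Base) (z : Basis Ψ ℂ V) (i : b.support) {X : End ℂ V}
    (hX : X ∈ rootLie b z) : (nOp P z i)⁻¹.val * X * (nOp P z i).val ∈ rootLie b z := by
  have he := eOp_mem_rootLie b z i
  have hf := fOp_mem_rootLie b z i
  have := oneAddSmul_inv_conj_mem (eOp_mul_self P z i) he 1 <|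
    oneAddSmul_inv_conj_mem (fOp_mul_self P z i) hf (-1) <|
    oneAddSmul_inv_conj_mem (eOp_mul_self P z i) he 1 hX
  simpa only [nOp, mul_inv_rev, Units.val_mul, mul_assoc] using this

/-- A root vector of the Lie algebra generated by the `e_i` and `f_i`, normalised up to sign. -/
structure IsRootVector (b : P.Base) (z : Basis Ψ ℂ V) (k : ι) (X : End ℂ V) : Prop where
  mem : X ∈ rootLie b z
  isSignedShift : IsSignedShift z (P.coroot' k) (P.root k) X
  unique : ∀ Y ∈ rootLie b z, Y ∈ shiftOps z (P.root k) → ∃ c : ℂ, Y = c • X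
  exists_opposite : ∃ Y ∈ rootLie b z, IsSignedShift z (-P.coroot' k) (-P.root k) Y ∧
    ⁅X, Y⁆ = weightOp z (P.coroot' k)

/-- Conjugation by `n_j` preserves the Lie algebra and moves weights by `s_j`. Uniqueness is pulled
back along the inverse conjugation. -/
theorem IsRootVector.conj (hΨ : IsMinusculeSet P Ψ) {b : P.Base} {z : Basis Ψ ℂ V} {k : ι}
    {X : End ℂ V} (hX : IsRootVector b z k X) (j : b.support) :
    IsRootVector b z (P.reflectionPerm j k) ((nOp P z j).val * X * (nOp P z j)⁻¹.val) := by
  have hn := nOp_isSignedReflection hΨ z (j : ι)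
  refine ⟨nOp_conj_mem b z j hX.mem, ?_, fun Y hY hYs => ?_, ?_⟩
  · rw [RootPairing.coroot'_reflectionPerm, RootPairing.root_reflectionPerm]
    exact hn.mul_mul_isSignedShift hΨ hn.inv hX.isSignedShift
  · rw [RootPairing.root_reflectionPerm] at hYs
    have h1 := hn.inv.mul_mul_mem_shiftOps hΨ hn hYs
    rw [reflection_reflection] at h1
    obtain ⟨c, hc⟩ := hX.unique _ (nOp_inv_conj_mem b z j hY) h1
    refine ⟨c, ?_⟩
    rw [← smul_mul_assoc, ← mul_smul_comm, ← hc]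
    simp only [mul_assoc, Units.mul_inv, mul_one]
    rw [← mul_assoc, Units.mul_inv, one_mul]
  · obtain ⟨Y, hY, hYs, hXY⟩ := hX.exists_opposite
    refine ⟨_, nOp_conj_mem b z j hY, ?_, ?_⟩
    · rw [RootPairing.coroot'_reflectionPerm, RootPairing.root_reflectionPerm]
      have := hn.mul_mul_isSignedShift hΨ hn.inv hYs
      rwa [map_neg, LinearMap.neg_comp] at this
    · rw [RootPairing.coroot'_reflectionPerm, ← hn.mul_weightOp_mul, ← hXY, Ring.lie_def,
        Ring.lie_def]
      have key : ∀ A B : End ℂ V, ((nOp P z j).val * A * (nOp P z j)⁻¹.val) *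
          ((nOp P z j).val * B * (nOp P z j)⁻¹.val) =
          (nOp P z j).val * (A * B) * (nOp P z j)⁻¹.val := fun A B => by
        simp only [mul_assoc]
        rw [← mul_assoc (nOp P z j)⁻¹.val, Units.inv_mul, one_mul]
      rw [key, key, mul_sub, sub_mul]

theorem eOp_isSignedShift (z : Basis Ψ ℂ V) (i : ι) :
    IsSignedShift z (P.coroot' i) (P.root i) (eOp P z i) :=
  ⟨fun μ hμ h => ⟨1, Or.inl rfl, by rw [eOp_apply_of_eq z hμ h, one_smul]⟩,
    fun μ hμ h => eOp_apply_of_ne z hμ h⟩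

theorem fOp_isSignedShift (z : Basis Ψ ℂ V) (i : ι) :
    IsSignedShift z (-P.coroot' i) (-P.root i) (fOp P z i) := by
  refine ⟨fun μ hμ h => ⟨1, Or.inl rfl, ?_⟩, fun μ hμ h => fOp_apply_of_ne z hμ fun h' => h ?_⟩
  · rw [fOp_apply_of_eq z hμ (by simpa using h), one_smul, sub_eq_add_neg]
  · rw [LinearMap.neg_apply, h']

variable [Finite ι] [P.IsCrystallographic]

theorem eq_smul_eOp_of_mem_rootLie (hΨ : IsMinusculeSet P Ψ) (b : P.Base) (z : Basis Ψ ℂ V)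
    (i : b.support) {Y : End ℂ V} (hY : Y ∈ rootLie b z) (hYs : Y ∈ shiftOps z (P.root i)) :
    ∃ c : ℂ, Y = c • eOp P z i := by
  have hr : LinearIndependent ℚ fun i : b.support => P.root i := b.linearIndepOn_root
  have he : ∀ i : b.support, eOp P z i ∈ shiftOps z (P.root i) := fun i => eOp_mem_shiftOps z _
  have hf : ∀ i : b.support, fOp P z i ∈ shiftOps z ((-fun i : b.support => P.root i) i) :=
    fun i => fOp_mem_shiftOps z _
  exact eq_smul_of_mem_triangularSpan hr he hf (rootLie_le_triangularSpan hΨ b z hY) hYs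

theorem eOp_isRootVector (hΨ : IsMinusculeSet P Ψ) (b : P.Base) (z : Basis Ψ ℂ V) (i : b.support) :
    IsRootVector b z i (eOp P z i) where
  mem := eOp_mem_rootLie b z i
  isSignedShift := eOp_isSignedShift (P := P) z (i : ι)
  unique _ hY hYs := eq_smul_eOp_of_mem_rootLie hΨ b z i hY hYs
  exists_opposite := ⟨fOp P z i, fOp_mem_rootLie b z i, fOp_isSignedShift (P := P) z (i : ι),
    eOp_lie_fOp_self hΨ z (i : ι)⟩

theorem isRootVector_list_conj (hΨ : IsMinusculeSet P Ψ) (b : P.Base) (z : Basis Ψ ℂ V)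
    (i : b.support) (l : List b.support) :
    ∃ k, P.root k = (l.map fun j : b.support => P.reflection j.1).prod (P.root i) ∧
      IsRootVector b z k ((l.map fun j : b.support => nOp P z j.1).prod.val * eOp P z i *
        (l.map fun j : b.support => nOp P z j.1).prod⁻¹.val) := by
  induction l with
  | nil => exact ⟨i, by simp, by simpa using eOp_isRootVector hΨ b z i⟩
  | cons j l ih =>
    obtain ⟨k, hk, hX⟩ := ih
    refine ⟨P.reflectionPerm j k, ?_, ?_⟩
    · rw [RootPairing.root_reflectionPerm, hk, List.map_cons, List.prod_cons]
      rfl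
    · have := hX.conj hΨ j
      simpa only [List.map_cons, List.prod_cons, mul_inv_rev, Units.val_mul, mul_assoc] using this

theorem IsRootVectorChoice.isRootVector (hΨ : IsMinusculeSet P Ψ) {b : P.Base} {z : Basis Ψ ℂ V}
    {e : E → End ℂ V} (he : IsRootVectorChoice b z e) (k : ι) :
    IsRootVector b z k (e (P.root k)) := by
  obtain ⟨i, l, h1, h2⟩ := he (P.root k) ⟨k, rfl⟩
  obtain ⟨m, hm, hX⟩ := isRootVector_list_conj hΨ b z i l
  rw [← h1] at hm
  rw [h2, ← P.root.injective hm]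
  exact hX

end RootVectors

/-! ### Nonzero weights of the Lie algebra are roots -/

section RootSpaces

set_option linter.unusedSectionVars false

variable {ι E N V : Type*} [Finite ι] [AddCommGroup E] [Module ℚ E] [AddCommGroup N] [Module ℚ N]
  [AddCommGroup V] [Module ℂ V] {P : RootPairing ι ℚ E N} {Ψ : Set E}

theorem rootForm_self_mul_coroot [Fintype ι] (i : ι) (v : E) :
    P.RootForm (P.root i) (P.root i) * P.coroot' i v = 2 * P.RootForm (P.root i) v := by
  have h := congrArg (P.toLinearMap v) (P.rootForm_self_smul_coroot i)
  rw [map_smul, map_nsmul, RootPairing.toLinearMap_apply_apply_Polarization, smul_eq_mul,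
    nsmul_eq_mul] at h
  exact_mod_cast h

theorem rootForm_self_pos [Fintype ι] [P.IsRootSystem] {v : E} (hv : v ≠ 0) :
    0 < P.RootForm v v := by
  rw [RootPairing.rootForm_apply_apply]
  have hex : ∃ k, P.coroot' k v ≠ 0 := by
    by_contra! hall
    apply hv
    have htop : ∀ f : N, P.toLinearMap v f = 0 := fun f => by
      have hf : f ∈ Submodule.span ℚ (Set.range P.coroot) := by
        rw [RootPairing.IsRootSystem.span_coroot_eq_top]
        trivial
      induction hf using Submodule.span_induction with
      | mem f hf =>
        obtain ⟨k, rfl⟩ := hf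
        exact hall k
      | zero => exact map_zero _
      | add f g _ _ hf hg => rw [map_add, hf, hg, add_zero]
      | smul t f _ hf => rw [map_smul, hf, smul_zero]
    have : P.toLinearMap v = P.toLinearMap 0 := by
      ext f
      rw [htop, map_zero, LinearMap.zero_apply]
    exact LinearMap.IsPerfPair.bijective_left (p := P.toLinearMap) |>.injective this
  obtain ⟨k, hk⟩ := hex
  exact Finset.sum_pos' (fun i _ => mul_self_nonneg _) ⟨k, Finset.mem_univ _, mul_self_pos.2 hk⟩

/-- Otherwise `(γ, γ) = ∑ n_i (α_i, γ) ≤ 0`, against positive definiteness. -/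
theorem exists_pos_coroot_of_sum (b : P.Base) [P.IsRootSystem] {n : b.support → ℕ} {γ : E}
    (hγ : γ = ∑ i, n i • P.root i) (h0 : γ ≠ 0) : ∃ i, 0 < n i ∧ 0 < P.coroot' i γ := by
  have := Fintype.ofFinite ι
  by_contra! h
  refine (rootForm_self_pos (P := P) h0).not_ge ?_
  have hexp : P.RootForm γ γ = ∑ i : b.support, (n i : ℚ) * P.RootForm (P.root i) γ := by
    nth_rewrite 1 [hγ]
    simp [map_sum, LinearMap.sum_apply]
  rw [hexp]
  refine Finset.sum_nonpos fun i _ => ?_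
  obtain hn | hn := Nat.eq_zero_or_pos (n i)
  · simp [hn]
  · refine mul_nonpos_of_nonneg_of_nonpos (Nat.cast_nonneg _) ?_
    have h4 : P.RootForm (P.root i) (P.root i) * P.coroot' i γ ≤ 0 :=
      mul_nonpos_of_nonneg_of_nonpos (rootForm_self_pos (P.ne_zero _)).le (h i hn)
    rw [rootForm_self_mul_coroot] at h4
    linarith

variable [P.IsCrystallographic] [P.IsRootSystem]

/-- The weight `γ` occurs in the Lie algebra generated by the `e_i` and `f_i`. -/
def IsLieWeight (b : P.Base) (z : Basis Ψ ℂ V) (γ : E) : Prop :=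
  ∃ X ∈ rootLie b z, X ∈ shiftOps z γ ∧ X ≠ 0

theorem IsLieWeight.reflection (hΨ : IsMinusculeSet P Ψ) {b : P.Base} {z : Basis Ψ ℂ V} {γ : E}
    (hγ : IsLieWeight b z γ) (i : b.support) : IsLieWeight b z (P.reflection i γ) := by
  obtain ⟨X, hXL, hX, hX0⟩ := hγ
  refine ⟨_, nOp_conj_mem b z i hXL, (nOp_isSignedReflection hΨ z (i : ι)).mul_mul_mem_shiftOps hΨ
      (nOp_isSignedReflection hΨ z (i : ι)).inv hX, fun h => hX0 ?_⟩
  rwa [Units.mul_left_eq_zero, Units.mul_right_eq_zero] at h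

theorem IsLieWeight.cases (hΨ : IsMinusculeSet P Ψ) {b : P.Base} {z : Basis Ψ ℂ V} {γ : E}
    (hγ : IsLieWeight b z γ ∨ IsLieWeight b z (-γ)) : γ = 0 ∨ γ ∈ Set.range P.root ∨
      IsMixedSum (fun i : b.support => P.root i) γ ∨
      IsMixedSum (fun i : b.support => P.root i) (-γ) := by
  have key : ∀ δ, IsLieWeight b z δ → δ = 0 ∨ δ ∈ Set.range P.root ∨
      IsMixedSum (fun i : b.support => P.root i) δ ∨
      IsMixedSum (fun i : b.support => P.root i) (-δ) := by
    rintro δ ⟨X, hXL, hX, hX0⟩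
    obtain h | ⟨j, h⟩ | ⟨j, h⟩ | h | h := weight_of_mem_triangularSpan
      (r := fun i : b.support => P.root i)
      (fun _ => eOp_mem_shiftOps z _) (fun _ => fOp_mem_shiftOps z _)
      (rootLie_le_triangularSpan hΨ b z hXL) hX0 hX
    · exact Or.inl h
    · exact Or.inr (Or.inl ⟨j, h.symm⟩)
    · refine Or.inr (Or.inl ⟨P.reflectionPerm j j, ?_⟩)
      rw [h, RootPairing.root_reflectionPerm, RootPairing.reflection_apply_self]
    · exact Or.inr (Or.inr (Or.inl h))
    · exact Or.inr (Or.inr (Or.inr h))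
  obtain h | h := hγ
  · exact key γ h
  · obtain h | h | h | h := key _ h
    · exact Or.inl (neg_eq_zero.1 h)
    · exact Or.inr (Or.inl (P.neg_mem_range_root_iff.1 h))
    · exact Or.inr (Or.inr (Or.inr h))
    · rw [neg_neg] at h
      exact Or.inr (Or.inr (Or.inl h))

/-- Induction on the height `m`. A simple reflection `s_i` with `(γ, α_i^∨) > 0` gives another
weight, equal to `γ` except for a smaller coefficient at `α_i`; it is a root exactly when `γ` is.
Allowing `γ` or `-γ` as a weight treats negative combinations too. -/
theorem mem_range_root_of_isMixedSum (hΨ : IsMinusculeSet P Ψ) (b : P.Base) (z : Basis Ψ ℂ V)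
    (m : ℕ) : ∀ (n : b.support → ℕ) (γ : E), ∑ i, n i = m → γ = ∑ i, n i • P.root i →
      (∃ i j, i ≠ j ∧ 0 < n i ∧ 0 < n j) → IsLieWeight b z γ ∨ IsLieWeight b z (-γ) →
      γ ∈ Set.range P.root := by
  classical
  induction m using Nat.strong_induction_on with
  | _ m ih =>
    intro n γ hnm hγ hn hX
    have hr : LinearIndependent ℚ fun i : b.support => P.root i := b.linearIndepOn_root
    have hmix : IsMixedSum (fun i : b.support => P.root i) γ := ⟨n, hγ, hn⟩
    obtain ⟨k, l, hkl, hk, hl⟩ := hn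
    have hγ0 : γ ≠ 0 := by simpa using hmix.ne hr k 0
    obtain ⟨i, hi, hit⟩ := exists_pos_coroot_of_sum b hγ hγ0
    set t := P.coroot' i γ with ht
    have hrefl : P.reflection i γ = γ - t • P.root i := RootPairing.reflection_apply ..
    have hX' : IsLieWeight b z (P.reflection i γ) ∨ IsLieWeight b z (-P.reflection i γ) := by
      rw [← map_neg]
      exact hX.imp (fun h => h.reflection hΨ i) fun h => h.reflection hΨ i
    have hback : P.reflection i γ ∈ Set.range P.root → γ ∈ Set.range P.root := by
      rintro ⟨j, hj⟩
      exact ⟨P.reflectionPerm i j, by rw [RootPairing.root_reflectionPerm, hj,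
        reflection_reflection]⟩
    obtain h | h | ⟨p, hp, hp2⟩ | ⟨p, hp, hp2⟩ := IsLieWeight.cases hΨ hX'
    · rw [hrefl, sub_eq_zero] at h
      exact absurd h (hmix.ne hr i t)
    · exact hback h
    · have h1 : ∑ j : b.support, ((n j : ℚ) - Pi.single (M := fun _ => ℚ) i t j - p j) • P.root j
          = 0 := by
        simp only [sub_smul, Finset.sum_sub_distrib, Nat.cast_smul_eq_nsmul, ← hγ, ← hp, hrefl]
        simp [Pi.single_apply]
      have h2 := Fintype.linearIndependent_iff.1 hr _ h1
      -- Comparing sums of coefficients shows that the height drops by `t > 0`.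
      have h3 : (∑ j, (n j : ℚ)) - t - ∑ j, (p j : ℚ) = 0 := by
        have := Finset.sum_eq_zero fun j (_ : j ∈ Finset.univ) => h2 j
        simpa [Finset.sum_sub_distrib] using this
      have h4 : ∑ j, p j < m := by
        rw [← hnm]
        have : ((∑ j, p j : ℕ) : ℚ) < ((∑ j, n j : ℕ) : ℚ) := by
          push_cast
          linarith
        exact_mod_cast this
      exact hback (ih _ h4 p _ rfl hp hp2 hX')
    -- A negative combination is impossible: the reflection changes only the coefficient at `i`,
    -- while `n` is positive at some other index.
    · exfalso
      have h1 : ∑ j : b.support, ((n j : ℚ) - Pi.single (M := fun _ => ℚ) i t j + p j) • P.root j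
          = 0 := by
        simp only [sub_smul, add_smul, Finset.sum_add_distrib, Finset.sum_sub_distrib,
          Nat.cast_smul_eq_nsmul, ← hγ, ← hp, hrefl]
        simp [Pi.single_apply]
      have h2 := Fintype.linearIndependent_iff.1 hr _ h1
      have key : ∀ j, j ≠ i → n j = 0 := fun j hj => by
        have h3 := h2 j
        rw [Pi.single_eq_of_ne hj, sub_zero] at h3
        have h4 : n j + p j = 0 := by exact_mod_cast h3
        omega
      by_cases hki : k = i
      · exact hl.ne' (key l fun h => hkl (hki.trans h.symm))
      · exact hk.ne' (key k hki)

theorem IsLieWeight.mem_range_root (hΨ : IsMinusculeSet P Ψ) {b : P.Base} {z : Basis Ψ ℂ V}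
    {γ : E} (hγ : IsLieWeight b z γ) (h0 : γ ≠ 0) : γ ∈ Set.range P.root := by
  obtain h | h | ⟨n, hn, hn2⟩ | ⟨n, hn, hn2⟩ := IsLieWeight.cases hΨ (Or.inl hγ)
  · exact absurd h h0
  · exact h
  · exact mem_range_root_of_isMixedSum hΨ b z _ n γ rfl hn hn2 (Or.inl hγ)
  · refine P.neg_mem_range_root_iff.1
      (mem_range_root_of_isMixedSum hΨ b z _ n _ rfl hn hn2 (Or.inr ?_))
    rwa [neg_neg]

theorem eq_zero_of_notMem_range_root (hΨ : IsMinusculeSet P Ψ) {b : P.Base} {z : Basis Ψ ℂ V}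
    {γ : E} {X : End ℂ V} (hXL : X ∈ rootLie b z) (hX : X ∈ shiftOps z γ) (h0 : γ ≠ 0)
    (hγ : γ ∉ Set.range P.root) : X = 0 := by
  by_contra h
  exact hγ (IsLieWeight.mem_range_root hΨ ⟨X, hXL, hX, h⟩ h0)

end RootSpaces

/-! ### Pairs of roots, and exclusion of type G₂ -/

section RankTwo

set_option linter.unusedSectionVars false
set_option linter.overlappingInstances false

variable {ι E N : Type*} [Finite ι] [AddCommGroup E] [Module ℚ E] [AddCommGroup N] [Module ℚ N]
  {P : RootPairing ι ℚ E N} {Ψ : Set E} [P.IsCrystallographic] [P.IsReduced]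

theorem pairing_eq_intCast (i j : ι) : P.pairing i j = (P.pairingIn ℤ i j : ℚ) := by
  rw [← P.algebraMap_pairingIn ℤ]
  rfl

/-- The coroot of `s_i(α_j)` is `α_j^∨ + 3 α_i^∨`, and two numbers in `{0, ±1}` cannot differ by
`±3`. -/
theorem coroot'_eq_zero_of_pairing_neg_three (hΨ : IsMinusculeSet P Ψ) {i j : ι}
    (h : P.pairing i j = -3) {μ : E} (hμ : μ ∈ Ψ) : P.coroot' i μ = 0 := by
  have hk : P.coroot' (P.reflectionPerm i j) μ = P.coroot' j μ + 3 * P.coroot' i μ := by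
    rw [RootPairing.coroot'_reflectionPerm, LinearMap.comp_apply]
    change P.coroot' j (P.reflection i μ) = _
    rw [RootPairing.reflection_apply, map_sub, map_smul, RootPairing.root_coroot'_eq_pairing, h,
      smul_eq_mul]
    ring
  obtain h1 | h1 | h1 := hΨ.coroot_mem μ hμ i
  · exact h1
  all_goals
    rw [h1] at hk
    obtain h2 | h2 | h2 := hΨ.coroot_mem μ hμ j <;>
    obtain h3 | h3 | h3 := hΨ.coroot_mem μ hμ (P.reflectionPerm i j) <;>
    rw [h2, h3] at hk <;> norm_num at hk

theorem isNotG2_of_isMinusculeSet [P.IsRootSystem] [P.IsIrreducible] (hΨ : IsMinusculeSet P Ψ)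
    (h0 : ∃ μ ∈ Ψ, μ ≠ 0) : P.IsNotG2 := by
  have := Fintype.ofFinite ι
  rw [← P.not_isG2_iff_isNotG2]
  intro hG
  let := RootPairing.IsG2.toEmbeddedG2 P
  obtain ⟨μ, hμ, hne⟩ := h0
  set l := RootPairing.EmbeddedG2.long P
  set s := RootPairing.EmbeddedG2.short P
  have hls : P.pairing l s = -3 := RootPairing.EmbeddedG2.pairing_long_short P
  have hsl : P.pairing s l = -1 := RootPairing.EmbeddedG2.pairing_short_long P
  have hl : P.coroot' l μ = 0 := coroot'_eq_zero_of_pairing_neg_three hΨ hls hμ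
  -- Applying `s_s` to the pair `(l, s)` gives another pair with pairing `-3`, so the coroot of
  -- `s_s(l)`, which is the sum of those of `l` and `s`, also vanishes on `μ`.
  have hs : P.coroot' s μ = 0 := by
    have h1 : P.pairing (P.reflectionPerm s l) (P.reflectionPerm s s) = -3 := by
      rw [RootPairing.pairing_reflectionPerm, RootPairing.reflectionPerm_self, hls]
    have h2 := coroot'_eq_zero_of_pairing_neg_three hΨ h1 hμ
    rw [RootPairing.coroot'_reflectionPerm, LinearMap.comp_apply] at h2
    change P.coroot' l (P.reflection s μ) = 0 at h2
    rw [RootPairing.reflection_apply, map_sub, map_smul, RootPairing.root_coroot'_eq_pairing, hsl,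
      hl, smul_eq_mul] at h2
    linarith
  have hform : ∀ k, P.coroot' k μ = 0 → P.RootForm (P.root k) μ = 0 := fun k hk => by
    have := rootForm_self_mul_coroot (P := P) k μ
    rw [hk, mul_zero] at this
    linarith
  have hall : ∀ v : E, P.RootForm v μ = 0 := fun v => by
    have hv : v ∈ Submodule.span ℚ {P.root l, P.root s} := by
      rw [RootPairing.EmbeddedG2.span_eq_top]
      trivial
    obtain ⟨a, c, rfl⟩ := Submodule.mem_span_pair.1 hv
    simp [hform l hl, hform s hs]
  exact (rootForm_self_pos (P := P) hne).ne' (hall μ)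

/-- Under these hypotheses `α_i + α_j = s_i(α_j)`, so its coroot is `s_i(α_j^∨)`. -/
theorem coroot'_of_pairing {i j k : ι} (hk : P.root k = P.root i + P.root j)
    (h : P.pairing j i = -1) (v : E) :
    P.coroot' k v = P.coroot' j v - P.pairing i j * P.coroot' i v := by
  have hkk : k = P.reflectionPerm i j := P.root.injective <| by
    rw [RootPairing.root_reflectionPerm, RootPairing.reflection_apply,
      RootPairing.root_coroot'_eq_pairing, h, hk]
    module
  rw [hkk, RootPairing.coroot'_reflectionPerm, LinearMap.comp_apply]
  change P.coroot' j (P.reflection i v) = _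
  rw [RootPairing.reflection_apply, map_sub, map_smul, RootPairing.root_coroot'_eq_pairing,
    smul_eq_mul, mul_comm]

theorem pairing_pos_of_pos {i j : ι} (h : 0 < P.pairing i j) : 0 < P.pairing j i := by
  rw [pairing_eq_intCast] at h ⊢
  have := P.zero_lt_pairingIn_iff' (S := ℤ) (i := i) (j := j)
  exact_mod_cast this.1 (by exact_mod_cast h)

theorem add_mem_range_root_of_pairing_neg {i j : ι} (h : P.pairing i j < 0)
    (hne : P.root j ≠ -P.root i) : P.root i + P.root j ∈ Set.range P.root := by
  refine P.root_add_root_mem_of_pairingIn_neg ?_ fun h' => hne (by rw [h', neg_neg])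
  rw [pairing_eq_intCast] at h
  exact_mod_cast h

theorem pairing_cases_of_add_mem [P.IsNotG2] {i j : ι} (hne : P.root j ≠ P.root i)
    (hne' : P.root j ≠ -P.root i)
    (h : P.root i + P.root j ∈ Set.range P.root) :
    P.pairing i j = 0 ∧ P.pairing j i = 0 ∨ P.pairing i j = -1 ∧ P.pairing j i = -1 ∨
      P.pairing i j = -1 ∧ P.pairing j i = -2 ∨ P.pairing i j = -2 ∧ P.pairing j i = -1 := by
  have h1 := P.pairingIn_le_zero_of_root_add_mem h
  have h2 := RootPairing.IsNotG2.pairingIn_mem_zero_one_two (P := P) i j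
  have h3 := RootPairing.IsNotG2.pairingIn_mem_zero_one_two (P := P) j i
  have h4 := P.pairingIn_pairingIn_mem_set_of_isCrystal_of_isRed' i j hne.symm
    (fun h' => hne' (by rw [h', neg_neg]))
  simp only [pairing_eq_intCast]
  simp only [Set.mem_insert_iff, Set.mem_singleton_iff, Prod.mk.injEq] at h2 h3 h4
  norm_cast
  omega

theorem sub_mem_range_root_iff [P.IsNotG2] {i j : ι}
    (h : P.root i + P.root j ∈ Set.range P.root) :
    P.root i - P.root j ∈ Set.range P.root ↔ P.pairing i j = 0 := by
  have hli := P.linearIndependent_of_add_mem_range_root' h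
  have h1 := P.root_sub_nsmul_mem_range_iff_le_chainBotCoeff hli (n := 1)
  rw [one_smul, P.chainBotCoeff_if_one_zero h, ← P.neg_mem_range_root_iff, neg_sub] at h1
  rw [h1, pairing_eq_intCast]
  split_ifs with h2 <;> simp [h2]

/-- Outside G₂ a root string has at most three members, so the `α_j`-string through `α_i` starts at
`α_i` and ends at `α_i + 2α_j`. -/
theorem pairing_eq_neg_two_of_add_two_smul_mem [P.IsNotG2] {i j : ι}
    (h : P.root i + P.root j ∈ Set.range P.root)
    (h2 : P.root i + (2 : ℚ) • P.root j ∈ Set.range P.root) : P.pairing i j = -2 := by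
  have hli := P.linearIndependent_of_add_mem_range_root' (add_comm (P.root i) (P.root j) ▸ h)
  have h1 : 2 ≤ P.chainTopCoeff j i := by
    rw [← P.root_add_nsmul_mem_range_iff_le_chainTopCoeff hli]
    rwa [two_smul ℚ, ← two_nsmul] at h2
  have h3 := P.chainBotCoeff_add_chainTopCoeff_le_two j i
  have h4 := P.chainBotCoeff_sub_chainTopCoeff hli
  rw [pairing_eq_intCast, ← h4]
  have h5 : P.chainBotCoeff j i = 0 := by omega
  have h6 : P.chainTopCoeff j i = 2 := by omega
  rw [h5, h6]
  norm_num

theorem add_two_smul_mem_of_pairing_eq {i j : ι} (h : P.pairing i j = -2) :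
    P.root i + (2 : ℚ) • P.root j ∈ Set.range P.root := by
  refine ⟨P.reflectionPerm j i, ?_⟩
  rw [RootPairing.root_reflectionPerm, RootPairing.reflection_apply,
    RootPairing.root_coroot'_eq_pairing, h]
  module

end RankTwo

/-! ### Products of signed shift operators -/

section Products

set_option linter.unusedSectionVars false

variable {ι E N V : Type*} [AddCommGroup E] [Module ℚ E] [AddCommGroup N] [Module ℚ N]
  [AddCommGroup V] [Module ℂ V] {P : RootPairing ι ℚ E N} {Ψ : Set E} {z : Basis Ψ ℂ V}
  {i j k : ι} {X Y Z : End ℂ V}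

/-- After `Y` the pairing with `α_i^∨` exceeds `-1`, so `X` kills the result. -/
theorem mul_eq_zero_of_pairing_pos (hΨ : IsMinusculeSet P Ψ)
    (hX : IsSignedShift z (P.coroot' i) (P.root i) X)
    (hY : IsSignedShift z (P.coroot' j) (P.root j) Y) (h : 0 < P.pairing j i) : X * Y = 0 := by
  refine end_ext z fun μ hμ => ?_
  rw [Module.End.mul_apply, LinearMap.zero_apply]
  by_cases h1 : P.coroot' j μ = -1
  · obtain ⟨s, -, hs⟩ := hY.apply_of_eq μ hμ h1
    rw [hs, map_smul, hX.apply_of_ne _ (hΨ.add_mem hμ h1), smul_zero]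
    rw [map_add, RootPairing.root_coroot'_eq_pairing]
    obtain h2 | h2 | h2 := hΨ.coroot_mem μ hμ i <;> rw [h2] <;> intro h3 <;> linarith
  · rw [hY.apply_of_ne μ hμ h1, map_zero]

theorem mul_self_eq_zero_of_isSignedShift (hΨ : IsMinusculeSet P Ψ)
    (hX : IsSignedShift z (P.coroot' i) (P.root i) X) : X * X = 0 :=
  mul_eq_zero_of_pairing_pos hΨ hX hX (by rw [RootPairing.pairing_same]; norm_num)

/-- For both factors `Y` to act, the pairing with `α_j^∨` must be `-1` before and `-1 + 2 + (α_i,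
α_j^∨) = -1` after `Y` and `X`. -/
theorem mul_mul_eq_zero_of_pairing_ne (hΨ : IsMinusculeSet P Ψ)
    (hX : IsSignedShift z (P.coroot' i) (P.root i) X)
    (hY : IsSignedShift z (P.coroot' j) (P.root j) Y) (h : P.pairing i j ≠ -2) :
    Y * X * Y = 0 := by
  refine end_ext z fun μ hμ => ?_
  rw [Module.End.mul_apply, Module.End.mul_apply, LinearMap.zero_apply]
  by_cases h1 : P.coroot' j μ = -1
  · obtain ⟨s, -, hs⟩ := hY.apply_of_eq μ hμ h1
    have hm := hΨ.add_mem hμ h1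
    rw [hs, map_smul, map_smul]
    by_cases h2 : P.coroot' i (μ + P.root j) = -1
    · obtain ⟨t, -, ht⟩ := hX.apply_of_eq _ hm h2
      rw [ht, map_smul, hY.apply_of_ne _ (hΨ.add_mem hm h2), smul_zero, smul_zero]
      rw [map_add, map_add, RootPairing.root_coroot'_eq_pairing,
        RootPairing.root_coroot'_eq_pairing, RootPairing.pairing_same, h1]
      intro h3
      apply h
      linarith
    · rw [hX.apply_of_ne _ hm h2, map_zero, smul_zero]
  · rw [hY.apply_of_ne μ hμ h1, map_zero, map_zero]

/-- A multiple of a signed shift operator which is itself given by signs is a multiple by a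
sign. -/
theorem exists_sign_of_eq_smul (hΨ : IsMinusculeSet P Ψ)
    (hZ : IsSignedShift z (P.coroot' k) (P.root k) Z) {W : End ℂ V} {c : ℂ} (hc : W = c • Z)
    (hW : ∀ μ ∈ Ψ, P.coroot' k μ = -1 →
      ∃ s : ℂ, (s = 1 ∨ s = -1) ∧ W (basisVec z μ) = s • basisVec z (μ + P.root k)) :
    ∃ c : ℂ, (c = 1 ∨ c = -1) ∧ W = c • Z := by
  by_cases h : ∃ μ ∈ Ψ, P.coroot' k μ = -1
  · obtain ⟨μ, hμ, h⟩ := h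
    obtain ⟨s, hs, hsμ⟩ := hW μ hμ h
    obtain ⟨t, ht, htμ⟩ := hZ.apply_of_eq μ hμ h
    refine ⟨c, ?_, hc⟩
    rw [hc, LinearMap.smul_apply, htμ, smul_smul] at hsμ
    have := smul_left_injective ℂ (basisVec_ne_zero z (hΨ.add_mem hμ h)) hsμ
    obtain rfl | rfl := ht <;> obtain rfl | rfl := hs
    · left; simpa using this
    · right; simpa using this
    · right; linear_combination -this
    · left; linear_combination -this
  -- If no weight pairs to `-1` with the coroot, then `Z = 0` and any sign will do.
  · push Not at h
    have hZ0 : Z = 0 := end_ext z fun μ hμ => by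
      rw [hZ.apply_of_ne μ hμ (h μ hμ), LinearMap.zero_apply]
    exact ⟨1, Or.inl rfl, by rw [hc, hZ0, smul_zero, smul_zero]⟩

/-- On each `z_μ` with `(μ, α_k^∨) = -1` exactly one of `X * Y` and `Y * X` is nonzero, so no two
terms add or cancel: `(μ, α_i^∨)` is `0` in the first case and `-1` in the second. -/
theorem lie_sign_of_pairing (hΨ : IsMinusculeSet P Ψ)
    (hX : IsSignedShift z (P.coroot' i) (P.root i) X)
    (hY : IsSignedShift z (P.coroot' j) (P.root j) Y)
    (hZ : IsSignedShift z (P.coroot' k) (P.root k) Z)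
    (hk : P.root k = P.root i + P.root j) (hji : P.pairing j i = -1)
    (hij : P.pairing i j = -1 ∨ P.pairing i j = -2)
    (hcork : ∀ v, P.coroot' k v = P.coroot' j v - P.pairing i j * P.coroot' i v)
    {c : ℂ} (hc : ⁅X, Y⁆ = c • Z) :
    ∃ c : ℂ, (c = 1 ∨ c = -1) ∧ ⁅X, Y⁆ = c • Z := by
  refine exists_sign_of_eq_smul hΨ hZ hc fun μ hμ hμk => ?_
  have hcor := hcork μ
  rw [hμk] at hcor
  have hcases : P.coroot' i μ = 0 ∧ P.coroot' j μ = -1 ∨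
      P.coroot' i μ = -1 ∧ P.coroot' j μ = -1 - P.pairing i j := by
    obtain h1 | h1 | h1 := hΨ.coroot_mem μ hμ i
    · left
      rw [h1] at hcor ⊢
      exact ⟨rfl, by linarith⟩
    · exfalso
      rw [h1] at hcor
      obtain h2 | h2 | h2 := hΨ.coroot_mem μ hμ j <;> rw [h2] at hcor <;>
        obtain h3 | h3 := hij <;> rw [h3] at hcor <;> norm_num at hcor
    · right
      rw [h1] at hcor ⊢
      exact ⟨rfl, by linarith⟩
  rw [Ring.lie_def, LinearMap.sub_apply, Module.End.mul_apply, Module.End.mul_apply, hk]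
  obtain ⟨hi, hj⟩ | ⟨hi, hj⟩ := hcases
  · obtain ⟨s, hs, hsμ⟩ := hY.apply_of_eq μ hμ hj
    obtain ⟨t, ht, htμ⟩ := hX.apply_of_eq _ (hΨ.add_mem hμ hj)
      (by rw [map_add, RootPairing.root_coroot'_eq_pairing, hi, hji, zero_add])
    refine ⟨s * t, ?_, ?_⟩
    · obtain rfl | rfl := hs <;> obtain rfl | rfl := ht <;> norm_num
    · rw [hsμ, map_smul, htμ, hX.apply_of_ne μ hμ (by rw [hi]; norm_num), map_zero, sub_zero,
        smul_smul, add_assoc, add_comm (P.root j)]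
  · obtain ⟨s, hs, hsμ⟩ := hX.apply_of_eq μ hμ hi
    obtain ⟨t, ht, htμ⟩ := hY.apply_of_eq _ (hΨ.add_mem hμ hi)
      (by rw [map_add, RootPairing.root_coroot'_eq_pairing, hj]; ring)
    refine ⟨-(s * t), ?_, ?_⟩
    · obtain rfl | rfl := hs <;> obtain rfl | rfl := ht <;> norm_num
    · have hne : P.coroot' j μ ≠ -1 := by
        rw [hj]
        obtain h3 | h3 := hij <;> rw [h3] <;> norm_num
      rw [hsμ, map_smul, htμ, hY.apply_of_ne μ hμ hne, map_zero, zero_sub,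
        smul_smul, neg_smul, add_assoc]

/-- Every word in the expanded products contains `XX`, `YY` or `XYX`. -/
theorem mul_eq_zero_of_mem_brackets (hXX : X * X = 0) (hYY : Y * Y = 0) (hXYX : X * Y * X = 0) :
    ∀ x ∈ ({X, ⁅X, Y⁆, Y * X * Y} : Set (End ℂ V)),
      ∀ y ∈ ({X, ⁅X, Y⁆, Y * X * Y} : Set (End ℂ V)), x * y = 0 := by
  have h1 : ∀ A, X * (X * A) = 0 := fun A => by rw [← mul_assoc, hXX, zero_mul]
  have h2 : ∀ A, Y * (Y * A) = 0 := fun A => by rw [← mul_assoc, hYY, zero_mul]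
  have h3 : X * (Y * X) = 0 := by rw [← mul_assoc, hXYX]
  have h4 : ∀ A, X * (Y * (X * A)) = 0 := fun A => by
    rw [← mul_assoc, ← mul_assoc, hXYX, zero_mul]
  simp only [Set.mem_insert_iff, Set.mem_singleton_iff]
  rintro x (rfl | rfl | rfl) y (rfl | rfl | rfl) <;>
    simp only [Ring.lie_def, mul_sub, sub_mul, mul_assoc, hXX, h1, h2, h3, h4, mul_zero,
      sub_zero]

end Products

/-! ### Commutators and triple products of root vectors -/

section Relations

set_option linter.unusedSectionVars false
set_option linter.overlappingInstances false

variable {ι E N V : Type*} [Finite ι] [AddCommGroup E] [Module ℚ E] [AddCommGroup N] [Module ℚ N]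
  [AddCommGroup V] [Module ℂ V] {P : RootPairing ι ℚ E N} {Ψ : Set E} {z : Basis Ψ ℂ V}
  [P.IsCrystallographic] [P.IsReduced] [P.IsRootSystem] {b : P.Base}
  {i j k : ι} {X Y Z : End ℂ V}

theorem IsRootVector.lie_eq_zero (hΨ : IsMinusculeSet P Ψ) (hX : IsRootVector b z i X)
    (hY : IsRootVector b z j Y) (hne : P.root j ≠ -P.root i)
    (h : P.root i + P.root j ∉ Set.range P.root) : ⁅X, Y⁆ = 0 :=
  eq_zero_of_notMem_range_root hΨ ((rootLie b z).lie_mem hX.mem hY.mem)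
    (lie_mem_shiftOps hX.isSignedShift.mem_shiftOps hY.isSignedShift.mem_shiftOps)
    (fun h0 => hne (eq_neg_of_add_eq_zero_right h0)) h

theorem IsRootVector.exists_lie_eq_smul (hX : IsRootVector b z i X)
    (hY : IsRootVector b z j Y) (hZ : IsRootVector b z k Z)
    (hk : P.root k = P.root i + P.root j) : ∃ c : ℂ, ⁅X, Y⁆ = c • Z := by
  refine hZ.unique _ ((rootLie b z).lie_mem hX.mem hY.mem) ?_
  rw [hk]
  exact lie_mem_shiftOps hX.isSignedShift.mem_shiftOps hY.isSignedShift.mem_shiftOps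

theorem IsRootVector.lie_eq_sign_smul [P.IsNotG2] (hΨ : IsMinusculeSet P Ψ)
    (hX : IsRootVector b z i X)
    (hY : IsRootVector b z j Y) (hZ : IsRootVector b z k Z)
    (hne : P.root j ≠ P.root i) (hne' : P.root j ≠ -P.root i)
    (hk : P.root k = P.root i + P.root j) (h0 : P.pairing i j ≠ 0) :
    ∃ c : ℂ, (c = 1 ∨ c = -1) ∧ ⁅X, Y⁆ = c • Z := by
  obtain ⟨c, hc⟩ := hX.exists_lie_eq_smul hY hZ hk
  have hk' : P.root k = P.root j + P.root i := by rw [hk, add_comm]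
  have hXs := hX.isSignedShift
  have hYs := hY.isSignedShift
  have hZs := hZ.isSignedShift
  -- The sign computation needs its second root to have pairing `-1` with the first; here the two
  -- roles are exchanged.
  have hswap : P.pairing i j = -1 → (P.pairing j i = -1 ∨ P.pairing j i = -2) →
      ∃ c : ℂ, (c = 1 ∨ c = -1) ∧ ⁅X, Y⁆ = c • Z := fun h1 h2 => by
    obtain ⟨d, hd, hdZ⟩ := lie_sign_of_pairing hΨ hYs hXs hZs hk' h1 h2
      (coroot'_of_pairing hk' h1) (c := -c) (by rw [← lie_skew, hc, neg_smul])
    refine ⟨-d, ?_, by rw [← lie_skew, hdZ, neg_smul]⟩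
    obtain rfl | rfl := hd <;> simp
  obtain h | h | h | h := pairing_cases_of_add_mem hne hne' ⟨k, hk⟩
  · exact absurd h.1 h0
  · exact hswap h.1 (Or.inl h.2)
  · exact hswap h.1 (Or.inr h.2)
  · exact lie_sign_of_pairing hΨ hXs hYs hZs hk h.2 (Or.inr h.1) (coroot'_of_pairing hk h.2) hc

/-- Let `T` be opposite to `X`, with `[X, T] = H`. The roots of `Z` and `T` are not orthogonal, so
`[Z, T] = ±Y` by the sign case. As `[X, Z] = 0`, the Jacobi identity gives `±[X, Y] = [Z, H] = -2
Z`, the `2` being `(α_k, α_i^∨)`. -/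
theorem IsRootVector.lie_eq_two_smul [P.IsNotG2] (hΨ : IsMinusculeSet P Ψ)
    (hX : IsRootVector b z i X)
    (hY : IsRootVector b z j Y) (hZ : IsRootVector b z k Z)
    (hk : P.root k = P.root i + P.root j) (hij : P.pairing i j = 0) :
    ∃ c : ℂ, (c = 2 ∨ c = -2) ∧ ⁅X, Y⁆ = c • Z := by
  have hji : P.pairing j i = 0 := by rwa [RootPairing.pairing_eq_zero_iff']
  have hki : P.pairing k i = 2 := by
    rw [← RootPairing.root_coroot'_eq_pairing, hk, map_add, RootPairing.root_coroot'_eq_pairing,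
      RootPairing.root_coroot'_eq_pairing, hji, RootPairing.pairing_same, add_zero]
  obtain ⟨T, hTL, hTs, hXT⟩ := hX.exists_opposite
  set i' := P.reflectionPerm i i with hi'
  have hri : P.root i' = -P.root i := by
    rw [hi', RootPairing.root_reflectionPerm, RootPairing.reflection_apply_self]
  have hci : P.coroot' i' = -P.coroot' i := by
    ext v
    rw [hi', RootPairing.coroot'_reflectionPerm, LinearMap.comp_apply]
    change P.coroot' i (P.reflection i v) = _
    rw [RootPairing.reflection_apply, map_sub, map_smul, coroot'_root_self, smul_eq_mul,
      LinearMap.neg_apply]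
    ring
  rw [← hri, ← hci] at hTs
  have hki' : P.pairing k i' = -2 := by
    rw [← RootPairing.root_coroot'_eq_pairing, hci, LinearMap.neg_apply,
      RootPairing.root_coroot'_eq_pairing, hki]
  have hj : P.root j = P.root k + P.root i' := by rw [hri, hk]; abel
  have hne1 : P.root i' ≠ P.root k := by
    intro h
    have := P.root.injective h
    rw [this, RootPairing.pairing_same] at hki'
    norm_num at hki'
  have hne2 : P.root i' ≠ -P.root k := by
    rw [hri]
    intro h
    have := P.ne_zero j
    rw [neg_inj, hk, left_eq_add] at h
    exact this h
  have hi'k : P.pairing i' k = -1 := by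
    obtain h | h | h | h := pairing_cases_of_add_mem hne1 hne2 ⟨j, hj⟩
    all_goals first | exact h.2 | (exfalso; have := h.1; rw [hki'] at this; norm_num at this)
  have hTZmem : ⁅Z, T⁆ ∈ shiftOps z (P.root j) := by
    rw [hj]
    exact lie_mem_shiftOps hZ.isSignedShift.mem_shiftOps hTs.mem_shiftOps
  obtain ⟨c, hc⟩ := hY.unique _ ((rootLie b z).lie_mem hZ.mem hTL) hTZmem
  obtain ⟨d, hd, hdY⟩ := lie_sign_of_pairing hΨ hZ.isSignedShift hTs hY.isSignedShift hj hi'k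
    (Or.inr hki') (coroot'_of_pairing hj hi'k) hc
  have hXZ : ⁅X, Z⁆ = 0 := by
    rw [Ring.lie_def, mul_eq_zero_of_pairing_pos hΨ hX.isSignedShift hZ.isSignedShift
      (by rw [hki]; norm_num), mul_eq_zero_of_pairing_pos hΨ hZ.isSignedShift hX.isSignedShift
      (pairing_pos_of_pos (by rw [hki]; norm_num)), sub_zero]
  have hjac : ⁅X, ⁅Z, T⁆⁆ = (-2 : ℂ) • Z := by
    rw [leibniz_lie, hXZ, zero_lie, zero_add, hXT, ← lie_skew,
      weightOp_lie _ hZ.isSignedShift.mem_shiftOps, RootPairing.root_coroot'_eq_pairing, hki]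
    push_cast
    module
  rw [hdY, lie_smul] at hjac
  obtain rfl | rfl := hd
  · exact ⟨-2, Or.inr rfl, by rw [← hjac, one_smul]⟩
  · refine ⟨2, Or.inl rfl, ?_⟩
    rw [neg_smul, one_smul, neg_eq_iff_eq_neg] at hjac
    rw [hjac]
    module

theorem IsRootVector.mul_mul_eq_sign_smul (hΨ : IsMinusculeSet P Ψ)
    (hX : IsRootVector b z i X) (hY : IsRootVector b z j Y) (hZ : IsRootVector b z k Z)
    (hk : P.root k = P.root i + (2 : ℚ) • P.root j) (hij : P.pairing i j = -2)
    (hji : P.pairing j i = -1) :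
    ∃ c : ℂ, (c = 1 ∨ c = -1) ∧ Y * X * Y = c • Z := by
  have hkk : k = P.reflectionPerm j i := P.root.injective <| by
    rw [RootPairing.root_reflectionPerm, RootPairing.reflection_apply,
      RootPairing.root_coroot'_eq_pairing, hij, hk]
    module
  have hcor : ∀ v, P.coroot' k v = P.coroot' i v + P.coroot' j v := fun v => by
    rw [hkk, RootPairing.coroot'_reflectionPerm, LinearMap.comp_apply]
    change P.coroot' i (P.reflection j v) = _
    rw [RootPairing.reflection_apply, map_sub, map_smul, RootPairing.root_coroot'_eq_pairing, hji,
      smul_eq_mul]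
    ring
  have hYY := mul_self_eq_zero_of_isSignedShift hΨ hY.isSignedShift
  have hXs := hX.isSignedShift
  have hYs := hY.isSignedShift
  -- An associative product need not lie in the Lie algebra; this one does because `Y * Y = 0` makes
  -- it `-1/2` times `[Y, [Y, X]]`.
  have hL : Y * X * Y ∈ rootLie b z := by
    have h1 : Y * X * Y = (-1 / 2 : ℂ) • ⁅Y, ⁅Y, X⁆⁆ := by
      rw [lie_lie_of_mul_self hYY]
      module
    rw [h1]
    exact (rootLie b z).smul_mem _
      ((rootLie b z).lie_mem hY.mem ((rootLie b z).lie_mem hY.mem hX.mem))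
  have hS : Y * X * Y ∈ shiftOps z (P.root k) := by
    have := mul_mem_shiftOps (mul_mem_shiftOps hYs.mem_shiftOps hXs.mem_shiftOps) hYs.mem_shiftOps
    rwa [show P.root j + P.root i + P.root j = P.root k by rw [hk]; module] at this
  obtain ⟨c, hc⟩ := hZ.unique _ hL hS
  refine exists_sign_of_eq_smul hΨ hZ.isSignedShift hc fun μ hμ hμk => ?_
  have hr : ∃ m, P.root m = P.root i + P.root j := by
    refine ⟨P.reflectionPerm i j, ?_⟩
    rw [RootPairing.root_reflectionPerm, RootPairing.reflection_apply,
      RootPairing.root_coroot'_eq_pairing, hji]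
    module
  obtain ⟨m, hm⟩ := hr
  have hcorm := coroot'_of_pairing hm hji μ
  rw [hcor] at hμk
  rw [hij] at hcorm
  -- The two pairings add up to `-1`. The alternative `(-1, 0)` would make the coroot of `α_i +
  -- α_j`, which is `α_j^∨ + 2 α_i^∨`, take the value `-2`.
  have hpq : P.coroot' i μ = 0 ∧ P.coroot' j μ = -1 := by
    obtain h1 | h1 | h1 := hΨ.coroot_mem μ hμ i
    · exact ⟨h1, by linarith⟩
    · exfalso
      obtain h2 | h2 | h2 := hΨ.coroot_mem μ hμ j <;> linarith
    · exfalso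
      obtain h2 | h2 | h2 := hΨ.coroot_mem μ hμ m <;> linarith
  have hm1 := hΨ.add_mem hμ hpq.2
  have h1 : P.coroot' i (μ + P.root j) = -1 := by
    rw [map_add, RootPairing.root_coroot'_eq_pairing, hpq.1, hji, zero_add]
  have h2 : P.coroot' j (μ + P.root j + P.root i) = -1 := by
    rw [map_add, map_add, coroot'_root_self, RootPairing.root_coroot'_eq_pairing, hpq.2, hij]
    norm_num
  obtain ⟨s, hs, hsμ⟩ := hYs.apply_of_eq μ hμ hpq.2
  obtain ⟨t, ht, htμ⟩ := hXs.apply_of_eq _ hm1 h1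
  obtain ⟨u, hu, huμ⟩ := hYs.apply_of_eq _ (hΨ.add_mem hm1 h1) h2
  refine ⟨s * t * u, ?_, ?_⟩
  · obtain rfl | rfl := hs <;> obtain rfl | rfl := ht <;> obtain rfl | rfl := hu <;> norm_num
  · rw [Module.End.mul_apply, Module.End.mul_apply, hsμ, map_smul, map_smul, htμ, map_smul, huμ,
      smul_smul, smul_smul, hk, show μ + P.root j + P.root i + P.root j =
        μ + (P.root i + (2 : ℚ) • P.root j) by module]

end Relations

end MinusculeModel

end

theorem proposition2p5 {ι E N V : Type*} [Finite ι]
    [AddCommGroup E] [Module ℚ E] [AddCommGroup N] [Module ℚ N]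
    (P : RootPairing ι ℚ E N) [P.IsRootSystem] [P.IsCrystallographic] [P.IsReduced]
    [P.IsIrreducible] (b : P.Base)
    (Ψ : Set E) (hΨ : MinusculeModel.IsUnionOfMinusculeOrbits b Ψ)
    [AddCommGroup V] [Module ℂ V] (z : Module.Basis Ψ ℂ V)
    (e : E → Module.End ℂ V) (he : MinusculeModel.IsRootVectorChoice b z e)
    (α β : E) (hα : α ∈ MinusculeModel.roots P) (hβ : β ∈ MinusculeModel.roots P)
    (hne : β ≠ α) (hne' : β ≠ -α) :
    (α + β ∉ MinusculeModel.roots P → ⁅e α, e β⁆ = 0 ∧ e β * e α * e β = 0) ∧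
    (α + β ∈ MinusculeModel.roots P →
      ∃ c : ℂ, c ∈ ({1, -1, 2, -2} : Set ℂ) ∧ ⁅e α, e β⁆ = c • e (α + β) ∧
        (c ∈ ({2, -2} : Set ℂ) ↔ α - β ∈ MinusculeModel.roots P)) ∧
    (α + β ∈ MinusculeModel.roots P → (2 : ℚ) • α + β ∉ MinusculeModel.roots P →
      (∀ x ∈ ({e α, ⁅e α, e β⁆, e β * e α * e β} : Set (Module.End ℂ V)),
        ∀ y ∈ ({e α, ⁅e α, e β⁆, e β * e α * e β} : Set (Module.End ℂ V)), x * y = 0) ∧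
      (α + (2 : ℚ) • β ∈ MinusculeModel.roots P →
        ∃ c' : ℂ, c' ∈ ({1, -1} : Set ℂ) ∧ e β * e α * e β = c' • e (α + (2 : ℚ) • β)) ∧
      (α + (2 : ℚ) • β ∉ MinusculeModel.roots P → e β * e α * e β = 0)) := by
  have hM := hΨ.isMinusculeSet
  have := MinusculeModel.isNotG2_of_isMinusculeSet hM hΨ.exists_ne_zero
  obtain ⟨i, rfl⟩ := hα
  obtain ⟨j, rfl⟩ := hβ
  have hX := he.isRootVector hM i
  have hY := he.isRootVector hM j
  refine ⟨fun h => ⟨hX.lie_eq_zero hM hY hne' h, ?_⟩, fun h => ?_, fun h h2 => ⟨?_, ?_, ?_⟩⟩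
  · refine MinusculeModel.mul_mul_eq_zero_of_pairing_ne hM hX.isSignedShift hY.isSignedShift
      fun h' => h ?_
    exact MinusculeModel.add_mem_range_root_of_pairing_neg (by rw [h']; norm_num) hne'
  · obtain ⟨k, hk⟩ := h
    have hZ := he.isRootVector hM k
    rw [show P.root i - P.root j ∈ MinusculeModel.roots P ↔ P.pairing i j = 0 from
      MinusculeModel.sub_mem_range_root_iff ⟨k, hk⟩, ← hk]
    by_cases h0 : P.pairing i j = 0
    · obtain ⟨c, hc, hcZ⟩ := hX.lie_eq_two_smul hM hY hZ hk h0
      refine ⟨c, ?_, hcZ, ?_⟩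
      · obtain rfl | rfl := hc <;> simp
      · obtain rfl | rfl := hc <;> simp [h0]
    · obtain ⟨c, hc, hcZ⟩ := hX.lie_eq_sign_smul hM hY hZ hne hne' hk h0
      refine ⟨c, ?_, hcZ, ?_⟩
      · obtain rfl | rfl := hc <;> simp
      · obtain rfl | rfl := hc <;> norm_num [h0]
  -- Here `𝐞_α 𝐞_β 𝐞_α = 0`: otherwise `(β, α^∨) = -2`, and `s_α(β) = 2α + β` would be a root.
  · refine MinusculeModel.mul_eq_zero_of_mem_brackets
      (MinusculeModel.mul_self_eq_zero_of_isSignedShift hM hX.isSignedShift)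
      (MinusculeModel.mul_self_eq_zero_of_isSignedShift hM hY.isSignedShift)
      (MinusculeModel.mul_mul_eq_zero_of_pairing_ne hM hY.isSignedShift hX.isSignedShift
        fun h' => h2 ?_)
    rw [add_comm]
    exact MinusculeModel.add_two_smul_mem_of_pairing_eq h'
  · rintro ⟨k, hk⟩
    have hij := MinusculeModel.pairing_eq_neg_two_of_add_two_smul_mem h ⟨k, hk⟩
    have hji : P.pairing j i = -1 := by
      obtain h' | h' | h' | h' := MinusculeModel.pairing_cases_of_add_mem hne hne' h
      all_goals first | exact h'.2 | (exfalso; have := h'.1; rw [hij] at this; norm_num at this)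
    obtain ⟨c, hc, hcZ⟩ :=
      hX.mul_mul_eq_sign_smul hM hY (he.isRootVector hM k) hk hij hji
    exact ⟨c, hc, by rw [hcZ, hk]⟩
  · intro h3
    exact MinusculeModel.mul_mul_eq_zero_of_pairing_ne hM hX.isSignedShift hY.isSignedShift
      fun h' => h3 (MinusculeModel.add_two_smul_mem_of_pairing_eq h')
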